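/- **Proposition (Empirical UOT excess identity).** Let $\Omega\subset\mathbb R^d$ be a bounded convex Borel set, $c(x,y)=\tfrac12\|x-y\|^2$, and let $\mu,\nu$ be nonzero finite positive Borel measures on $\Omega$ with total masses $M_\mu=\mu(\Omega)$, $M_\nu=\nu(\Omega)$. For finite measures put $$\mathrm{UOT}(\mu,\nu)=\inf_{\gamma}\Big\{\int_{\Omega\times\Omega} c\,d\gamma+D_{\mathrm{KL}}(\gamma_0\mid\mu)+D_{\mathrm{KL}}(\gamma_1\mid\nu)\Big\},$$ the infimum being over all finite positive measures $\gamma$ on $\Omega\times\Omega$, with marginals $\gamma_0,\gamma_1$; here $D_{\mathrm{KL}}(\eta\mid\sigma)=\int F(d\eta/d\sigma)\,d\sigma$ with $F(r)=r\log r-r+1$ if $\eta\ll\sigma$, and $+\infty$ otherwise. For vectors $a\ge0$, $b>0$ put $D_{\mathrm{KL}}(a\mid b)=\sum_i b_iF(a_i/b_i)$. Let $(\varphi_0,\psi_0)$ be an optimal dual pair, i.e. a maximizer of $$\int_\Omega(1-e^{-\varphi})\,d\mu+\int_\Omega(1-e^{-\psi})\,d\nu$$ over all $(\varphi,\psi)\in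 C_b(\Omega)^2$ with $\varphi(x)+\psi(y)\le c(x,y)$ for all $x,y\in\Omega$, and put $\zeta_0=1-e^{-\varphi_0}$, $\xi_0=1-e^{-\psi_0}$. Let $n,m\ge1$. (a) Let $X_1,\dots,X_n,Y_1,\dots,Y_m\in\Omega$, $\tilde\mu_n=\frac{M_\mu}{n}\sum_i\delta_{X_i}$, $\tilde\nu_m=\frac{M_\nu}{m}\sum_j\delta_{Y_j}$, $\tilde\mu_i=M_\mu/n$, $\tilde\nu_j=M_\nu/m$. Let $\tilde\gamma$ be any minimizer over $G\in\mathbb R_+^{n\times m}$ of $$\sum_{i,j}c(X_i,Y_j)G_{ij}+D_{\mathrm{KL}}\Big(\big(\textstyle\sum_jG_{ij}\big)_i\,\Big|\,(\tilde\mu_i)_i\Big)+D_{\mathrm{KL}}\Big(\big(\textstyle\sum_iG_{ij}\big)_j\,\Big|\,(\tilde\nu_j)_j\Big),$$ and put $\tilde r_i=\sum_j\tilde\gamma_{ij}$, $\tilde s_j=\sum_i\tilde\gamma_{ij}$, $r_i^\star=e^{-\varphi_0(X_i)}\tilde\mu_i$, $s_j^\star=e^{-\psi_0(Y_j)}\tilde\nu_j$.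 Then $$\mathrm{UOT}(\tilde\mu_n,\tilde\nu_m)-\int\zeta_0\,d\tilde\mu_n-\int\xi_0\,d\tilde\nu_m=\sum_{i,j}\tilde\gamma_{ij}\big(c(X_i,Y_j)-\varphi_0(X_i)-\psi_0(Y_j)\big)+D_{\mathrm{KL}}(\tilde r\mid r^\star)+D_{\mathrm{KL}}(\tilde s\mid s^\star),$$ and the right-hand side is nonnegative. (b) If $X_1,\dots,X_n\sim\mu/M_\mu$ and $Y_1,\dots,Y_m\sim\nu/M_\nu$ are mutually independent random variables and $\tilde\gamma$ is, almost surely, a minimizer as in (a), then both random variables below are integrable and $$\mathbb E\Big[\sum_{i,j}\tilde\gamma_{ij}\big(c(X_i,Y_j)-\varphi_0(X_i)-\psi_0(Y_j)\big)+D_{\mathrm{KL}}(\tilde r\mid r^\star)+D_{\mathrm{KL}}(\tilde s\mid s^\star)\Big]=\mathbb E\big[\mathrm{UOT}(\tilde\mu_n,\tilde\nu_m)-\mathrm{UOT}(\mu,\nu)\big].$$ -/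

import Mathlib

open MeasureTheory ProbabilityTheory InformationTheory
open scoped ENNReal BoundedContinuousFunction

noncomputable section

namespace UOT

/-- The quadratic cost `c(x, y) = ‖x - y‖² / 2`. -/
def cost {d : ℕ} (x y : EuclideanSpace ℝ (Fin d)) : ℝ := ‖x - y‖ ^ 2 / 2

/-! ### The Kantorovich problem

`Ω` is a subset of `ℝᵈ`; measures on `Ω` are measures on the subtype with its Borel σ-algebra. -/

section Kantorovich

variable {d : ℕ} {Ω : Set (EuclideanSpace ℝ (Fin d))}

/-- The Kantorovich objective `∫ c dγ + KL(γ₀ | μ) + KL(γ₁ | ν)`, with values in `[0, ∞]`.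
Mathlib's `klDiv η μ`, for finite measures, is `∫ F(dη/dμ) dμ` with `F(r) = r log r - r + 1`
if `η ≪ μ`, and `∞` otherwise. -/
def primalObjective (μ ν : Measure Ω) (γ : Measure (Ω × Ω)) : ℝ≥0∞ :=
  (∫⁻ z, ENNReal.ofReal (cost (z.1 : EuclideanSpace ℝ (Fin d)) z.2) ∂γ)
    + klDiv γ.fst μ + klDiv γ.snd ν

/-- The infimum of the objective over all finite positive measures on `Ω × Ω`, in `[0, ∞]`. -/
def uotENNReal (μ ν : Measure Ω) : ℝ≥0∞ :=
  ⨅ γ : FiniteMeasure (Ω × Ω), primalObjective μ ν (γ : Measure (Ω × Ω))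

/-- The zero plan shows that the infimum is finite, so that no information is lost by `toReal`
in the definition of `uot`. -/
theorem uotENNReal_ne_top (μ ν : Measure Ω) [IsFiniteMeasure μ] [IsFiniteMeasure ν] :
    uotENNReal μ ν ≠ ∞ := by
  refine ne_top_of_le_ne_top ?_ (iInf_le _ (0 : FiniteMeasure (Ω × Ω)))
  simp [primalObjective, klDiv_zero_left]

/-- `UOT(μ, ν)`, as a real number. -/
def uot (μ ν : Measure Ω) : ℝ := (uotENNReal μ ν).toReal

/-! ### The dual problem -/

/-- The dual constraint `φ(x) + ψ(y) ≤ ‖x - y‖² / 2` on `Ω × Ω`. -/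
def DualFeasible (φ ψ : Ω →ᵇ ℝ) : Prop :=
  ∀ x y : Ω, φ x + ψ y ≤ cost (x : EuclideanSpace ℝ (Fin d)) y

/-- The dual objective `∫ (1 - e^{-φ}) dμ + ∫ (1 - e^{-ψ}) dν`. -/
def dualObjective (μ ν : Measure Ω) (φ ψ : Ω →ᵇ ℝ) : ℝ :=
  (∫ x, (1 - Real.exp (-φ x)) ∂μ) + ∫ y, (1 - Real.exp (-ψ y)) ∂ν

/-- `(φ, ψ)` is a maximizer of the dual problem over `C_b(Ω)²`. That the maximum equals
`UOT(μ, ν)` is not part of the definition. -/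
structure IsOptimalDualPair (μ ν : Measure Ω) (φ ψ : Ω →ᵇ ℝ) : Prop where
  feasible : DualFeasible φ ψ
  optimal : ∀ φ' ψ' : Ω →ᵇ ℝ, DualFeasible φ' ψ' →
    dualObjective μ ν φ' ψ' ≤ dualObjective μ ν φ ψ

/-- The function `-(e^{-φ} - 1)`: it is `ζ₀` for `φ = φ₀` and `ξ₀` for `φ = ψ₀`. -/
def effective (φ : Ω →ᵇ ℝ) (x : Ω) : ℝ := -(Real.exp (-φ x) - 1)

/-! ### Empirical measures with the true masses -/

/-- `(M / n) ∑ᵢ δ_{xᵢ}`, where `M = μ(Ω)`. -/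
def oracleEmpirical (μ : Measure Ω) {n : ℕ} (x : Fin n → Ω) : Measure Ω :=
  (μ Set.univ / (n : ℝ≥0∞)) • ∑ i, Measure.dirac (x i)

/-- The atomic mass `M / n`, where `M = μ(Ω)`. -/
def atomMass (μ : Measure Ω) (n : ℕ) : ℝ := μ.real Set.univ / (n : ℝ)

/-- The normalized law `μ / μ(Ω)`. -/
def normalized (μ : Measure Ω) : Measure Ω := (μ Set.univ)⁻¹ • μ

end Kantorovich

/-! ### The discrete problem -/

section Discrete

variable {n m : ℕ}

/-- `KL(a | b) = ∑ᵢ bᵢ F(aᵢ / bᵢ)`, `F(r) = r log r - r + 1`, for nonnegative `a` and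
positive `b`. -/
def discreteKL (a b : Fin n → ℝ) : ℝ := ∑ i, b i * klFun (a i / b i)

/-- Row masses of a matrix. -/
def rowMass (G : Matrix (Fin n) (Fin m) ℝ) (i : Fin n) : ℝ := ∑ j, G i j

/-- Column masses of a matrix. -/
def colMass (G : Matrix (Fin n) (Fin m) ℝ) (j : Fin m) : ℝ := ∑ i, G i j

/-- The discrete objective `∑ᵢⱼ Cᵢⱼ Gᵢⱼ + KL(G₀ | a) + KL(G₁ | b)`. -/
def discreteObjective (C : Matrix (Fin n) (Fin m) ℝ) (a : Fin n → ℝ) (b : Fin m → ℝ)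
    (G : Matrix (Fin n) (Fin m) ℝ) : ℝ :=
  (∑ i, ∑ j, C i j * G i j) + discreteKL (rowMass G) a + discreteKL (colMass G) b

/-- `G` minimizes the discrete objective over all matrices with nonnegative entries. -/
structure IsOptimalDiscretePlan (C : Matrix (Fin n) (Fin m) ℝ) (a : Fin n → ℝ) (b : Fin m → ℝ)
    (G : Matrix (Fin n) (Fin m) ℝ) : Prop where
  nonneg : ∀ i j, 0 ≤ G i j
  optimal : ∀ G' : Matrix (Fin n) (Fin m) ℝ, (∀ i j, 0 ≤ G' i j) →
    discreteObjective C a b G ≤ discreteObjective C a b G'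

end Discrete

section Empirical

variable {d : ℕ} {Ω : Set (EuclideanSpace ℝ (Fin d))} {n m : ℕ}

/-- `G` is an optimal discrete plan between `(M_μ / n) ∑ᵢ δ_{xᵢ}` and `(M_ν / m) ∑ⱼ δ_{yⱼ}`. -/
def IsOptimalEmpiricalPlan (μ ν : Measure Ω) (x : Fin n → Ω) (y : Fin m → Ω)
    (G : Matrix (Fin n) (Fin m) ℝ) : Prop :=
  IsOptimalDiscretePlan
    (fun i j => cost (x i : EuclideanSpace ℝ (Fin d)) (y j))
    (fun _ => atomMass μ n) (fun _ => atomMass ν m) G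

/-- The empirical active marginal `e^{-φ(xᵢ)} M / n`: it is `r*` for `(μ, φ₀)` and `s*` for
`(ν, ψ₀)`. -/
def activeMarginal (μ : Measure Ω) (φ : Ω →ᵇ ℝ) (x : Fin n → Ω) (i : Fin n) : ℝ :=
  Real.exp (-φ (x i)) * atomMass μ n

/-- `∑ᵢⱼ Gᵢⱼ (c(xᵢ, yⱼ) - φ(xᵢ) - ψ(yⱼ)) + KL(r | r*) + KL(s | s*)`, where `r` and `s` are
the row and column masses of `G`. -/
def excessDecomposition (μ ν : Measure Ω) (φ ψ : Ω →ᵇ ℝ) (x : Fin n → Ω) (y : Fin m → Ω)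
    (G : Matrix (Fin n) (Fin m) ℝ) : ℝ :=
  (∑ i, ∑ j, G i j * (cost (x i : EuclideanSpace ℝ (Fin d)) (y j) - φ (x i) - ψ (y j)))
    + discreteKL (rowMass G) (activeMarginal μ φ x)
    + discreteKL (colMass G) (activeMarginal ν ψ y)

end Empirical

end UOT

end

noncomputable section

namespace UOT

/-! ### Kullback-Leibler divergence of densities and of atomic measures -/

/-! The identity for given points is algebra resting on `mul_klFun_div_exp_mul`: replacing the
reference mass `a` by `e^{-t} a` changes `a F(r / a)` by exactly `r t - a (1 - e^{-t})`. Summed over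
rows and columns, the linear terms turn the cost into the reduced cost `c - φ₀ - ψ₀`, and the
constants are the integrals of `ζ₀` and `ξ₀`. Nonnegativity is dual feasibility together with `F ≥
0`.

The measure-theoretic infimum must equal the discrete minimum even when sample points coincide
(`uotENNReal_atomic_eq`). A matrix pushes forward to a plan, and data processing bounds its KL
terms. Conversely, a plan of finite objective becomes a matrix by splitting the mass of each atom
uniformly among the indices sharing it. All atoms carry the same reference mass, so this split
preserves the whole objective.

In expectation, the empirical integrals of `ζ₀` and `ξ₀` average to `∫ ζ₀ dμ` and `∫ ξ₀ dν`, whose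
sum is the dual objective. What remains is strong duality, `UOT(μ, ν) = dualObjective`. One
inequality is Fenchel-Young. For the other, first-order optimality says that `(φ₀, ψ₀)` solves the
linear Kantorovich dual for the marginals `e^{-φ₀} μ` and `e^{-ψ₀} ν`. Kantorovich duality, from the
Riesz extension and Riesz-Markov-Kakutani theorems on the closure of `Ω`, yields a coupling of these
marginals whose primal value is at most the dual value. -/

theorem klDiv_withDensity {α : Type*} [MeasurableSpace α] (σ : Measure α) [IsFiniteMeasure σ]
    {f : α → ℝ≥0∞} (hf : Measurable f) [IsFiniteMeasure (σ.withDensity f)] :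
    klDiv (σ.withDensity f) σ = ∫⁻ x, ENNReal.ofReal (klFun (f x).toReal) ∂σ := by
  rw [klDiv_eq_lintegral_klFun_of_ac (withDensity_absolutelyContinuous σ f)]
  refine lintegral_congr_ae ?_
  filter_upwards [Measure.rnDeriv_withDensity σ hf] with x hx
  rw [hx]

/-- The measure `∑ᵢ wᵢ δ_{xᵢ}`. -/
def atomic {α : Type*} [MeasurableSpace α] {ι : Type*} [Fintype ι] (w : ι → ℝ) (x : ι → α) :
    Measure α :=
  ∑ i, ENNReal.ofReal (w i) • Measure.dirac (x i)

section Atomic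

variable {α β ι : Type*} [MeasurableSpace α] [MeasurableSpace β] [Fintype ι]

theorem atomic_apply (w : ι → ℝ) (x : ι → α) {s : Set α} (hs : MeasurableSet s) :
    atomic w x s = ∑ i, ENNReal.ofReal (w i) * s.indicator 1 (x i) := by
  simp [atomic, Measure.finsetSum_apply, hs]

instance (w : ι → ℝ) (x : ι → α) : IsFiniteMeasure (atomic w x) := by
  constructor
  rw [atomic_apply _ _ MeasurableSet.univ]
  simp [ENNReal.sum_lt_top]

theorem lintegral_atomic (w : ι → ℝ) (x : ι → α) {f : α → ℝ≥0∞} (hf : Measurable f) :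
    ∫⁻ z, f z ∂(atomic w x) = ∑ i, ENNReal.ofReal (w i) * f (x i) := by
  simp [atomic, lintegral_smul_measure, lintegral_dirac' _ hf]

theorem map_atomic (w : ι → ℝ) (x : ι → α) {g : α → β} (hg : Measurable g) :
    (atomic w x).map g = atomic w (g ∘ x) := by
  ext s hs
  rw [Measure.map_apply hg hs, atomic_apply _ _ (hg hs), atomic_apply _ _ hs]
  rfl

theorem ae_atomic [MeasurableSingletonClass α] {w : ι → ℝ} {x : ι → α} {p : α → Prop}
    (h : ∀ i, p (x i)) : ∀ᵐ z ∂(atomic w x), p z := by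
  have : ∀ᵐ z ∂(atomic w x), z ∈ Set.range x := by
    rw [ae_iff]
    change atomic w x (Set.range x)ᶜ = 0
    rw [atomic_apply _ _ (Set.finite_range x).measurableSet.compl]
    simp
  filter_upwards [this] with z ⟨i, hi⟩
  exact hi ▸ h i

end Atomic

theorem discreteKL_nonneg {n : ℕ} {a b : Fin n → ℝ} (ha : ∀ i, 0 ≤ a i) (hb : ∀ i, 0 < b i) :
    0 ≤ discreteKL a b :=
  Finset.sum_nonneg fun i _ => mul_nonneg (hb i).le (klFun_nonneg (div_nonneg (ha i) (hb i).le))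

theorem ofReal_discreteKL {n : ℕ} {a b : Fin n → ℝ} (ha : ∀ i, 0 ≤ a i) (hb : ∀ i, 0 < b i) :
    ENNReal.ofReal (discreteKL a b)
      = ∑ i, ENNReal.ofReal (b i) * ENNReal.ofReal (klFun (a i / b i)) := by
  rw [discreteKL, ENNReal.ofReal_sum_of_nonneg]
  · simp_rw [ENNReal.ofReal_mul (hb _).le]
  · exact fun i _ => mul_nonneg (hb i).le (klFun_nonneg (div_nonneg (ha i) (hb i).le))

/-- The atoms `0, …, n - 1` of `Fin n` are distinct, so the density at `i` is `aᵢ / bᵢ` and equality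
holds. -/
theorem klDiv_atomic_id {n : ℕ} {a b : Fin n → ℝ} (ha : ∀ i, 0 ≤ a i) (hb : ∀ i, 0 < b i) :
    klDiv (atomic a id) (atomic b id) = ENNReal.ofReal (discreteKL a b) := by
  have hd : atomic a id = (atomic b id).withDensity fun i => ENNReal.ofReal (a i / b i) := by
    ext s hs
    rw [withDensity_apply _ hs, ← lintegral_indicator hs, lintegral_atomic _ _ (by fun_prop),
      atomic_apply _ _ hs]
    refine Finset.sum_congr rfl fun i _ => ?_
    by_cases hi : i ∈ s
    · simp [hi, ← ENNReal.ofReal_mul (hb i).le, mul_div_cancel₀ _ (hb i).ne']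
    · simp [hi]
  have : IsFiniteMeasure ((atomic b id).withDensity fun i => ENNReal.ofReal (a i / b i)) :=
    hd ▸ inferInstance
  rw [hd, klDiv_withDensity _ (by fun_prop), lintegral_atomic _ _ (by fun_prop),
    ofReal_discreteKL ha hb]
  refine Finset.sum_congr rfl fun i _ => ?_
  rw [id, ENNReal.toReal_ofReal (div_nonneg (ha i) (hb i).le)]

/-- Data processing along `x`. Only an inequality survives, since points that coincide merge their
masses. -/
theorem klDiv_atomic_le {α : Type*} [MeasurableSpace α] {n : ℕ} {a b : Fin n → ℝ}
    (ha : ∀ i, 0 ≤ a i) (hb : ∀ i, 0 < b i) (x : Fin n → α) :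
    klDiv (atomic a x) (atomic b x) ≤ ENNReal.ofReal (discreteKL a b) := by
  have hx : Measurable x := measurable_of_countable x
  have := klDiv_map_le (atomic a id) (atomic b id) hx
  rwa [map_atomic _ _ hx, map_atomic _ _ hx, klDiv_atomic_id ha hb] at this

/-! ### The uniform disintegration of an atomic measure along its atoms -/

section FiberWeight

variable {α : Type*} {n : ℕ}

open Classical in
/-- The probability that the index is `i` given that the atom is `z`, when the index is uniform
among those with the same atom. -/
def fiberWeight (x : Fin n → α) (i : Fin n) (z : α) : ℝ≥0∞ :=
  if z = x i then ((Finset.univ.filter fun k => x k = x i).card : ℝ≥0∞)⁻¹ else 0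

theorem card_fiber_ne_zero [DecidableEq α] (x : Fin n → α) (i : Fin n) :
    ((Finset.univ.filter fun k => x k = x i).card : ℝ≥0∞) ≠ 0 := by
  simp only [ne_eq, Nat.cast_eq_zero, Finset.card_eq_zero]
  exact Finset.ne_empty_of_mem (a := i) (by simp)

theorem sum_fiberWeight_left (x : Fin n → α) (k : Fin n) : ∑ i, fiberWeight x i (x k) = 1 := by
  classical
  have : ∀ i, fiberWeight x i (x k)
      = if x i = x k then ((Finset.univ.filter fun l => x l = x k).card : ℝ≥0∞)⁻¹ else 0 := by
    intro i
    unfold fiberWeight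
    by_cases h : x i = x k
    · simp [h]
    · simp [h, Ne.symm h]
  simp_rw [this]
  rw [← Finset.sum_filter, Finset.sum_const, nsmul_eq_mul]
  exact ENNReal.mul_inv_cancel (card_fiber_ne_zero x k) (ENNReal.natCast_ne_top _)

/-- Here the index is fixed and the sample point varies; the sum is one because the split within
each fiber is uniform. -/
theorem sum_fiberWeight_right (x : Fin n → α) (i : Fin n) : ∑ k, fiberWeight x i (x k) = 1 := by
  classical
  simp_rw [fiberWeight]
  rw [← Finset.sum_filter, Finset.sum_const, nsmul_eq_mul]
  exact ENNReal.mul_inv_cancel (card_fiber_ne_zero x i) (ENNReal.natCast_ne_top _)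

theorem fiberWeight_mul_eq (x : Fin n → α) (i : Fin n) (z : α) (f : α → ℝ≥0∞) :
    fiberWeight x i z * f z = fiberWeight x i z * f (x i) := by
  unfold fiberWeight
  split_ifs with h
  · rw [h]
  · simp

variable [MeasurableSpace α] [MeasurableSingletonClass α]

@[fun_prop]
theorem measurable_fiberWeight (x : Fin n → α) (i : Fin n) : Measurable (fiberWeight x i) :=
  Measurable.ite (measurableSet_singleton (x i)) measurable_const measurable_const

/-- The masses `rᵢ = ∫ fiberWeight x i dη` satisfy `KL(r | b) = KL(η | b ∑ᵢ δ_{xᵢ})`. -/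
theorem ofReal_discreteKL_fiberWeight {x : Fin n → α} {b : ℝ} (hb : 0 < b) (η : Measure α)
    [IsFiniteMeasure η] (hη : η ≪ atomic (fun _ => b) x) :
    ENNReal.ofReal (discreteKL (fun i => (∫⁻ z, fiberWeight x i z ∂η).toReal) fun _ => b)
      = klDiv η (atomic (fun _ => b) x) := by
  set σ := atomic (fun _ => b) x
  have hf : Measurable (η.rnDeriv σ) := Measure.measurable_rnDeriv η σ
  -- The ratio `rᵢ / b` is the density at `xᵢ`, so the discrete KL has the same summands as the
  -- integral of `F` against `σ`.
  have hr : ∀ i, ∫⁻ z, fiberWeight x i z ∂η = ENNReal.ofReal b * η.rnDeriv σ (x i) := by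
    intro i
    rw [← Measure.withDensity_rnDeriv_eq η σ hη,
      lintegral_withDensity_eq_lintegral_mul _ hf (by fun_prop), lintegral_atomic _ _ (by fun_prop),
      Measure.withDensity_rnDeriv_eq η σ hη]
    simp_rw [Pi.mul_apply, mul_comm (η.rnDeriv σ _), fiberWeight_mul_eq x i]
    rw [← Finset.mul_sum, ← Finset.sum_mul, sum_fiberWeight_right, one_mul]
  rw [ofReal_discreteKL (fun _ => ENNReal.toReal_nonneg) fun _ => hb,
    klDiv_eq_lintegral_klFun_of_ac hη, lintegral_atomic _ _ (by fun_prop)]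
  refine Finset.sum_congr rfl fun i _ => ?_
  rw [hr, ENNReal.toReal_mul, ENNReal.toReal_ofReal hb.le, mul_div_cancel_left₀ _ hb.ne']

end FiberWeight

/-! ### The Kantorovich problem between empirical measures is the discrete problem -/

section Reduction

variable {d : ℕ} {Ω : Set (EuclideanSpace ℝ (Fin d))} {n m : ℕ}

theorem cost_nonneg (x y : EuclideanSpace ℝ (Fin d)) : 0 ≤ cost x y := by
  unfold cost; positivity

@[fun_prop]
theorem _root_.Continuous.uot_cost {X : Type*} [TopologicalSpace X]
    {f g : X → EuclideanSpace ℝ (Fin d)} (hf : Continuous f) (hg : Continuous g) :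
    Continuous fun z => cost (f z) (g z) := by
  unfold cost; fun_prop

/-- The matrix of costs between two families of points. -/
def costMatrix (x : Fin n → Ω) (y : Fin m → Ω) : Matrix (Fin n) (Fin m) ℝ :=
  Matrix.of fun i j => cost (x i : EuclideanSpace ℝ (Fin d)) (y j)

theorem costMatrix_nonneg (x : Fin n → Ω) (y : Fin m → Ω) (i : Fin n) (j : Fin m) :
    0 ≤ costMatrix x y i j :=
  cost_nonneg _ _

theorem discreteObjective_nonneg {C : Matrix (Fin n) (Fin m) ℝ} {a : Fin n → ℝ} {b : Fin m → ℝ}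
    (hC : ∀ i j, 0 ≤ C i j) (ha : ∀ i, 0 < a i) (hb : ∀ j, 0 < b j)
    {G : Matrix (Fin n) (Fin m) ℝ} (hG : ∀ i j, 0 ≤ G i j) : 0 ≤ discreteObjective C a b G :=
  add_nonneg (add_nonneg
    (Finset.sum_nonneg fun i _ => Finset.sum_nonneg fun j _ => mul_nonneg (hC i j) (hG i j))
    (discreteKL_nonneg (fun i => Finset.sum_nonneg fun j _ => hG i j) ha))
    (discreteKL_nonneg (fun j => Finset.sum_nonneg fun i _ => hG i j) hb)

theorem ofReal_discreteObjective {C : Matrix (Fin n) (Fin m) ℝ} {a : Fin n → ℝ} {b : Fin m → ℝ}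
    (hC : ∀ i j, 0 ≤ C i j) (ha : ∀ i, 0 < a i) (hb : ∀ j, 0 < b j)
    {G : Matrix (Fin n) (Fin m) ℝ} (hG : ∀ i j, 0 ≤ G i j) :
    ENNReal.ofReal (discreteObjective C a b G)
      = (∑ i, ∑ j, ENNReal.ofReal (C i j) * ENNReal.ofReal (G i j))
        + ENNReal.ofReal (discreteKL (rowMass G) a) + ENNReal.ofReal (discreteKL (colMass G) b) := by
  have h1 : ∀ i j, 0 ≤ C i j * G i j := fun i j => mul_nonneg (hC i j) (hG i j)
  have h2 : 0 ≤ discreteKL (rowMass G) a :=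
    discreteKL_nonneg (fun i => Finset.sum_nonneg fun j _ => hG i j) ha
  have h3 : 0 ≤ discreteKL (colMass G) b :=
    discreteKL_nonneg (fun j => Finset.sum_nonneg fun i _ => hG i j) hb
  have h4 : 0 ≤ ∑ i, ∑ j, C i j * G i j :=
    Finset.sum_nonneg fun i _ => Finset.sum_nonneg fun j _ => h1 i j
  rw [discreteObjective, ENNReal.ofReal_add (add_nonneg h4 h2) h3, ENNReal.ofReal_add h4 h2,
    ENNReal.ofReal_sum_of_nonneg fun i _ => Finset.sum_nonneg fun j _ => h1 i j]
  simp_rw [ENNReal.ofReal_sum_of_nonneg fun j (_ : j ∈ Finset.univ) => h1 _ j,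
    ENNReal.ofReal_mul (hC _ _)]

theorem fst_atomic_prod {α β : Type*} [MeasurableSpace α] [MeasurableSpace β]
    {G : Matrix (Fin n) (Fin m) ℝ} (hG : ∀ i j, 0 ≤ G i j) (x : Fin n → α) (y : Fin m → β) :
    (atomic (fun k : Fin n × Fin m => G k.1 k.2) fun k => (x k.1, y k.2)).fst
      = atomic (rowMass G) x := by
  ext s hs
  rw [Measure.fst, map_atomic _ _ measurable_fst, atomic_apply _ _ hs, atomic_apply _ _ hs,
    Fintype.sum_prod_type]
  refine Finset.sum_congr rfl fun i _ => ?_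
  rw [rowMass, ENNReal.ofReal_sum_of_nonneg fun j _ => hG i j, Finset.sum_mul]
  rfl

theorem snd_atomic_prod {α β : Type*} [MeasurableSpace α] [MeasurableSpace β]
    {G : Matrix (Fin n) (Fin m) ℝ} (hG : ∀ i j, 0 ≤ G i j) (x : Fin n → α) (y : Fin m → β) :
    (atomic (fun k : Fin n × Fin m => G k.1 k.2) fun k => (x k.1, y k.2)).snd
      = atomic (colMass G) y := by
  ext s hs
  rw [Measure.snd, map_atomic _ _ measurable_snd, atomic_apply _ _ hs, atomic_apply _ _ hs,
    Fintype.sum_prod_type_right]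
  refine Finset.sum_congr rfl fun j _ => ?_
  rw [colMass, ENNReal.ofReal_sum_of_nonneg fun i _ => hG i j, Finset.sum_mul]
  rfl

theorem uotENNReal_atomic_le {a : Fin n → ℝ} {b : Fin m → ℝ} (ha : ∀ i, 0 < a i)
    (hb : ∀ j, 0 < b j) (x : Fin n → Ω) (y : Fin m → Ω) {G : Matrix (Fin n) (Fin m) ℝ}
    (hG : ∀ i j, 0 ≤ G i j) :
    uotENNReal (atomic a x) (atomic b y)
      ≤ ENNReal.ofReal (discreteObjective
          (costMatrix x y) a b G) := by
  let γ : Measure (Ω × Ω) := atomic (fun k : Fin n × Fin m => G k.1 k.2) fun k => (x k.1, y k.2)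
  have : IsFiniteMeasure γ := by unfold γ; infer_instance
  refine (iInf_le _ (⟨γ, this⟩ : FiniteMeasure (Ω × Ω))).trans ?_
  rw [ofReal_discreteObjective (costMatrix_nonneg x y) ha hb hG]
  refine add_le_add (add_le_add ?_ ?_) ?_
  · change ∫⁻ z, _ ∂γ ≤ _
    unfold γ
    rw [lintegral_atomic _ _ (by fun_prop), Fintype.sum_prod_type]
    simp_rw [mul_comm]
    exact le_rfl
  · change klDiv γ.fst _ ≤ _
    rw [fst_atomic_prod hG]
    exact klDiv_atomic_le (fun i => Finset.sum_nonneg fun j _ => hG i j) ha x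
  · change klDiv γ.snd _ ≤ _
    rw [snd_atomic_prod hG]
    exact klDiv_atomic_le (fun j => Finset.sum_nonneg fun i _ => hG i j) hb y

/-- Absolute continuity puts the second marginal on the atoms `yⱼ`, where the weights in `j` sum to
one. -/
theorem lintegral_fiberWeight_mul_fiberWeight_left {α β : Type*} [MeasurableSpace α]
    [MeasurableSpace β] [MeasurableSingletonClass α] [MeasurableSingletonClass β]
    {b : Fin m → ℝ} (x : Fin n → α) (y : Fin m → β) (γ : Measure (α × β))
    (hγ : γ.snd ≪ atomic b y) (i : Fin n) :
    ∑ j, ∫⁻ z, fiberWeight x i z.1 * fiberWeight y j z.2 ∂γ = ∫⁻ z, fiberWeight x i z ∂γ.fst := by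
  rw [← lintegral_finsetSum' _ fun j _ => by fun_prop, Measure.fst,
    lintegral_map (by fun_prop) measurable_fst]
  have h1 : ∀ᵐ z ∂γ.snd, ∑ j, fiberWeight y j z = 1 :=
    hγ.ae_le (ae_atomic fun k => sum_fiberWeight_left y k)
  refine lintegral_congr_ae ?_
  filter_upwards [ae_of_ae_map measurable_snd.aemeasurable h1] with z hz
  rw [← Finset.mul_sum, hz, mul_one]

theorem lintegral_fiberWeight_mul_fiberWeight_right {α β : Type*} [MeasurableSpace α]
    [MeasurableSpace β] [MeasurableSingletonClass α] [MeasurableSingletonClass β]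
    {a : Fin n → ℝ} (x : Fin n → α) (y : Fin m → β) (γ : Measure (α × β))
    (hγ : γ.fst ≪ atomic a x) (j : Fin m) :
    ∑ i, ∫⁻ z, fiberWeight x i z.1 * fiberWeight y j z.2 ∂γ = ∫⁻ z, fiberWeight y j z ∂γ.snd := by
  rw [← lintegral_finsetSum' _ fun j _ => by fun_prop, Measure.snd,
    lintegral_map (by fun_prop) measurable_snd]
  have h1 : ∀ᵐ z ∂γ.fst, ∑ i, fiberWeight x i z = 1 :=
    hγ.ae_le (ae_atomic fun k => sum_fiberWeight_left x k)
  refine lintegral_congr_ae ?_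
  filter_upwards [ae_of_ae_map measurable_fst.aemeasurable h1] with z hz
  rw [← Finset.sum_mul, hz, one_mul]

theorem fiberWeight_le_one {α : Type*} (x : Fin n → α) (i : Fin n) (z : α) :
    fiberWeight x i z ≤ 1 := by
  classical
  unfold fiberWeight
  split_ifs
  · rw [ENNReal.inv_le_one]
    exact_mod_cast Finset.one_le_card.2 ⟨i, by simp⟩
  · exact zero_le_one

/-- Finiteness of the objective forces both marginals of `γ` onto the sample points. The matrix
built from fiber weights then has exactly the same cost and KL terms as `γ`. -/
theorem exists_ofReal_discreteObjective_le {a b : ℝ} (ha : 0 < a) (hb : 0 < b) (x : Fin n → Ω)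
    (y : Fin m → Ω) (γ : Measure (Ω × Ω)) [IsFiniteMeasure γ]
    (hγ : primalObjective (atomic (fun _ => a) x) (atomic (fun _ => b) y) γ ≠ ∞) :
    ∃ G : Matrix (Fin n) (Fin m) ℝ, (∀ i j, 0 ≤ G i j) ∧
      ENNReal.ofReal (discreteObjective (costMatrix x y)
          (fun _ => a) (fun _ => b) G)
        ≤ primalObjective (atomic (fun _ => a) x) (atomic (fun _ => b) y) γ := by
  have h1 : γ.fst ≪ atomic (fun _ => a) x := by
    by_contra h
    simp [primalObjective, klDiv_of_not_ac h] at hγ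
  have h2 : γ.snd ≪ atomic (fun _ => b) y := by
    by_contra h
    simp [primalObjective, klDiv_of_not_ac h] at hγ
  let g : Fin n → Fin m → ℝ≥0∞ := fun i j => ∫⁻ z, fiberWeight x i z.1 * fiberWeight y j z.2 ∂γ
  have hg : ∀ i j, g i j ≠ ∞ := fun i j =>
    ne_top_of_le_ne_top (measure_ne_top γ Set.univ) <| by
      refine (lintegral_mono fun z : Ω × Ω => mul_le_one' (fiberWeight_le_one x i z.1)
        (fiberWeight_le_one y j z.2)).trans ?_
      simp
  have hrow : rowMass (fun i j => (g i j).toReal)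
      = fun i => (∫⁻ z, fiberWeight x i z ∂γ.fst).toReal := by
    ext i
    rw [← lintegral_fiberWeight_mul_fiberWeight_left x y γ h2 i,
      ENNReal.toReal_sum fun j _ => hg i j]
    rfl
  have hcol : colMass (fun i j => (g i j).toReal)
      = fun j => (∫⁻ z, fiberWeight y j z ∂γ.snd).toReal := by
    ext j
    rw [← lintegral_fiberWeight_mul_fiberWeight_right x y γ h1 j,
      ENNReal.toReal_sum fun i _ => hg i j]
    rfl
  refine ⟨fun i j => (g i j).toReal, fun i j => ENNReal.toReal_nonneg, ?_⟩
  rw [ofReal_discreteObjective (costMatrix_nonneg x y) (fun _ => ha) (fun _ => hb)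
    fun i j => ENNReal.toReal_nonneg, hrow, hcol, ofReal_discreteKL_fiberWeight ha _ h1,
    ofReal_discreteKL_fiberWeight hb _ h2, primalObjective]
  refine le_of_eq ?_
  congr 2
  have hone : ∀ᵐ z ∂γ, ∑ i, ∑ j, fiberWeight x i z.1 * fiberWeight y j z.2 = 1 := by
    filter_upwards [ae_of_ae_map measurable_fst.aemeasurable
        (h1.ae_le (ae_atomic (p := fun z => ∑ i, fiberWeight x i z = 1)
          fun k => sum_fiberWeight_left x k)),
      ae_of_ae_map measurable_snd.aemeasurable
        (h2.ae_le (ae_atomic (p := fun z => ∑ j, fiberWeight y j z = 1)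
          fun k => sum_fiberWeight_left y k))] with z hz1 hz2
    simp_rw [← Finset.mul_sum, hz2, mul_one, hz1]
  calc ∑ i, ∑ j, ENNReal.ofReal (costMatrix x y i j)
        * ENNReal.ofReal (g i j).toReal
      = ∑ i, ∑ j, ∫⁻ z, fiberWeight x i z.1 * fiberWeight y j z.2
          * ENNReal.ofReal (cost (z.1 : EuclideanSpace ℝ (Fin d)) z.2) ∂γ := by
        refine Finset.sum_congr rfl fun i _ => Finset.sum_congr rfl fun j _ => ?_
        rw [ENNReal.ofReal_toReal (hg i j)]
        refine (lintegral_const_mul _ (by fun_prop)).symm.trans (lintegral_congr fun z => ?_)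
        -- Each weight vanishes off its own atom, so `cost z.1 z.2` may be replaced by `cost (x i)
        -- (y j)` one variable at a time.
        have e1 := fiberWeight_mul_eq y j z.2 fun v =>
          ENNReal.ofReal (cost (z.1 : EuclideanSpace ℝ (Fin d)) v)
        have e2 := fiberWeight_mul_eq x i z.1 fun u =>
          ENNReal.ofReal (cost (u : EuclideanSpace ℝ (Fin d)) (y j))
        rw [mul_assoc, e1, mul_left_comm (fiberWeight x i z.1), e2]
        change ENNReal.ofReal (cost (x i : EuclideanSpace ℝ (Fin d)) (y j)) * _ = _
        ring
    _ = ∫⁻ z, ∑ i, ∑ j, fiberWeight x i z.1 * fiberWeight y j z.2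
          * ENNReal.ofReal (cost (z.1 : EuclideanSpace ℝ (Fin d)) z.2) ∂γ := by
        rw [lintegral_finsetSum _ fun i _ => by fun_prop]
        refine Finset.sum_congr rfl fun i _ => ?_
        rw [lintegral_finsetSum _ fun j _ => by fun_prop]
    _ = _ := by
        refine lintegral_congr_ae ?_
        filter_upwards [hone] with z hz
        simp_rw [← Finset.sum_mul]
        rw [hz, one_mul]

theorem uotENNReal_atomic_eq {a b : ℝ} (ha : 0 < a) (hb : 0 < b) (x : Fin n → Ω)
    (y : Fin m → Ω) :
    uotENNReal (atomic (fun _ => a) x) (atomic (fun _ => b) y)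
      = ⨅ G : {G : Matrix (Fin n) (Fin m) ℝ // ∀ i j, 0 ≤ G i j},
        ENNReal.ofReal (discreteObjective (costMatrix x y)
          (fun _ => a) (fun _ => b) G) := by
  refine le_antisymm (le_iInf ?_) (le_iInf fun γ : FiniteMeasure (Ω × Ω) => ?_)
  · rintro ⟨G, hG⟩
    exact uotENNReal_atomic_le (fun _ => ha) (fun _ => hb) x y hG
  by_cases hγ : primalObjective (atomic (fun _ => a) x) (atomic (fun _ => b) y)
      (γ : Measure (Ω × Ω)) = ∞
  · rw [hγ]; exact le_top
  · obtain ⟨G, hG, hle⟩ := exists_ofReal_discreteObjective_le ha hb x y _ hγ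
    refine le_trans ?_ hle
    apply iInf_le_of_le ⟨G, hG⟩
    exact le_rfl

theorem uot_atomic_eq {a b : ℝ} (ha : 0 < a) (hb : 0 < b) (x : Fin n → Ω) (y : Fin m → Ω)
    {G : Matrix (Fin n) (Fin m) ℝ}
    (hG : IsOptimalDiscretePlan (costMatrix x y)
      (fun _ => a) (fun _ => b) G) :
    uot (atomic (fun _ => a) x) (atomic (fun _ => b) y)
      = discreteObjective (costMatrix x y)
          (fun _ => a) (fun _ => b) G := by
  rw [← ENNReal.toReal_ofReal (discreteObjective_nonneg (costMatrix_nonneg x y)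
    (fun _ => ha) (fun _ => hb) hG.nonneg), uot]
  congr 1
  refine le_antisymm (uotENNReal_atomic_le (fun _ => ha) (fun _ => hb) x y hG.nonneg) ?_
  rw [uotENNReal_atomic_eq ha hb]
  exact le_iInf fun G' => ENNReal.ofReal_le_ofReal (hG.optimal G'.1 G'.2)

/-- For each fixed matrix the discrete objective is continuous in the points. An infimum of such
functions, even an uncountable one, is upper semicontinuous, hence measurable. -/
theorem measurable_uot_atomic {a b : ℝ} (ha : 0 < a) (hb : 0 < b) :
    Measurable fun z : (Fin n → Ω) × (Fin m → Ω) =>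
      uot (atomic (fun _ => a) z.1) (atomic (fun _ => b) z.2) := by
  refine ENNReal.measurable_toReal.comp ?_
  simp_rw [uotENNReal_atomic_eq ha hb]
  have hc : ∀ i j, Continuous fun z : (Fin n → Ω) × (Fin m → Ω) => costMatrix z.1 z.2 i j := by
    intro i j
    unfold costMatrix
    simp only [Matrix.of_apply]
    fun_prop
  have hcont : ∀ G : Matrix (Fin n) (Fin m) ℝ, Continuous fun z : (Fin n → Ω) × (Fin m → Ω) =>
      discreteObjective (costMatrix z.1 z.2) (fun _ => a) (fun _ => b) G := by
    intro G
    unfold discreteObjective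
    fun_prop
  apply UpperSemicontinuous.measurable
  apply upperSemicontinuous_iInf
  rintro ⟨G, hG⟩
  exact (ENNReal.continuous_ofReal.comp (hcont G)).upperSemicontinuous

theorem uot_le (μ ν : Measure Ω) [IsFiniteMeasure μ] [IsFiniteMeasure ν] :
    uot μ ν ≤ μ.real Set.univ + ν.real Set.univ := by
  have h : uotENNReal μ ν ≤ μ Set.univ + ν Set.univ := by
    refine (iInf_le _ (0 : FiniteMeasure (Ω × Ω))).trans ?_
    simp [primalObjective, klDiv_zero_left]
  refine (ENNReal.toReal_mono (by simp) h).trans ?_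
  rw [ENNReal.toReal_add (measure_ne_top _ _) (measure_ne_top _ _)]
  rfl

theorem uot_nonneg (μ ν : Measure Ω) : 0 ≤ uot μ ν := ENNReal.toReal_nonneg

/-! ### The excess identity for given points -/

theorem atomMass_pos {μ : Measure Ω} [IsFiniteMeasure μ] (hμ : μ ≠ 0) (hn : 0 < n) :
    0 < atomMass μ n := by
  have : NeZero μ := ⟨hμ⟩
  exact div_pos (by simp [Measure.real, ENNReal.toReal_pos_iff, hμ, pos_iff_ne_zero])
    (by exact_mod_cast hn)

theorem oracleEmpirical_eq_atomic (μ : Measure Ω) [IsFiniteMeasure μ] (hn : 0 < n)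
    (x : Fin n → Ω) : oracleEmpirical μ x = atomic (fun _ => atomMass μ n) x := by
  rw [oracleEmpirical, atomic, Finset.smul_sum]
  refine Finset.sum_congr rfl fun i _ => ?_
  rw [atomMass, ENNReal.ofReal_div_of_pos (by exact_mod_cast hn), ENNReal.ofReal_natCast,
    ofReal_measureReal]

theorem integral_oracleEmpirical (μ : Measure Ω) (x : Fin n → Ω) (f : Ω → ℝ) :
    ∫ z, f z ∂(oracleEmpirical μ x) = ∑ i, atomMass μ n * f (x i) := by
  rw [oracleEmpirical, integral_smul_measure, integral_finsetSum_measure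
    fun i _ => integrable_dirac (by simp)]
  simp [atomMass, Measure.real, Finset.mul_sum]

/-- The factor `e^{-t}` contributes the additive term `t` to the logarithm of the ratio. This gives
the excess identity, and with `a = 1` also Fenchel-Young. -/
theorem mul_klFun_div_exp_mul {a r : ℝ} (ha : 0 < a) (hr : 0 ≤ r) (t : ℝ) :
    Real.exp (-t) * a * klFun (r / (Real.exp (-t) * a))
      = a * klFun (r / a) + r * t - a * (1 - Real.exp (-t)) := by
  rcases hr.eq_or_lt with rfl | hr
  · simp [klFun_zero]; ring
  have he := Real.exp_pos (-t)
  rw [klFun_apply, klFun_apply, Real.log_div hr.ne' (by positivity), Real.log_div hr.ne' ha.ne',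
    Real.log_mul he.ne' ha.ne', Real.log_exp]
  field_simp
  ring

theorem discreteKL_activeMarginal (μ : Measure Ω) (hμ : 0 < atomMass μ n) (φ : Ω →ᵇ ℝ)
    (x : Fin n → Ω) {r : Fin n → ℝ} (hr : ∀ i, 0 ≤ r i) :
    discreteKL r (activeMarginal μ φ x)
      = discreteKL r (fun _ => atomMass μ n) + ∑ i, r i * φ (x i)
        - ∑ i, atomMass μ n * effective φ (x i) := by
  rw [discreteKL, discreteKL, ← Finset.sum_add_distrib, ← Finset.sum_sub_distrib]
  refine Finset.sum_congr rfl fun i _ => ?_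
  rw [activeMarginal, mul_klFun_div_exp_mul hμ (hr i), effective]
  ring

/-- True for every nonnegative matrix and every pair of potentials; optimality of the plan enters
only in identifying the discrete objective with `uot`. -/
theorem excessDecomposition_eq (μ ν : Measure Ω) (hμ : 0 < atomMass μ n) (hν : 0 < atomMass ν m)
    (φ ψ : Ω →ᵇ ℝ) (x : Fin n → Ω) (y : Fin m → Ω) {G : Matrix (Fin n) (Fin m) ℝ}
    (hG : ∀ i j, 0 ≤ G i j) :
    excessDecomposition μ ν φ ψ x y G
      = discreteObjective (costMatrix x y)
          (fun _ => atomMass μ n) (fun _ => atomMass ν m) G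
        - (∑ i, atomMass μ n * effective φ (x i)) - ∑ j, atomMass ν m * effective ψ (y j) := by
  have hr : ∀ i, 0 ≤ rowMass G i := fun i => Finset.sum_nonneg fun j _ => hG i j
  have hs : ∀ j, 0 ≤ colMass G j := fun j => Finset.sum_nonneg fun i _ => hG i j
  rw [excessDecomposition, discreteObjective, discreteKL_activeMarginal μ hμ φ x hr,
    discreteKL_activeMarginal ν hν ψ y hs]
  have h1 : ∑ i, rowMass G i * φ (x i) = ∑ i, ∑ j, G i j * φ (x i) := by
    simp_rw [rowMass, Finset.sum_mul]
  have h2 : ∑ j, colMass G j * ψ (y j) = ∑ i, ∑ j, G i j * ψ (y j) := by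
    simp_rw [colMass, Finset.sum_mul]
    exact Finset.sum_comm
  rw [h1, h2]
  have h3 : ∑ i, ∑ j, G i j * (cost (x i : EuclideanSpace ℝ (Fin d)) (y j) - φ (x i) - ψ (y j))
      = (∑ i, ∑ j, costMatrix x y i j * G i j) - (∑ i, ∑ j, G i j * φ (x i))
        - ∑ i, ∑ j, G i j * ψ (y j) := by
    simp_rw [← Finset.sum_sub_distrib]
    refine Finset.sum_congr rfl fun i _ => Finset.sum_congr rfl fun j _ => ?_
    rw [costMatrix, Matrix.of_apply]
    ring
  rw [h3]
  ring

theorem excessDecomposition_nonneg (μ ν : Measure Ω) (hμ : 0 < atomMass μ n)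
    (hν : 0 < atomMass ν m) {φ ψ : Ω →ᵇ ℝ} (hφψ : DualFeasible φ ψ) (x : Fin n → Ω)
    (y : Fin m → Ω) {G : Matrix (Fin n) (Fin m) ℝ} (hG : ∀ i j, 0 ≤ G i j) :
    0 ≤ excessDecomposition μ ν φ ψ x y G := by
  refine add_nonneg (add_nonneg (Finset.sum_nonneg fun i _ => Finset.sum_nonneg fun j _ =>
      mul_nonneg (hG i j) ?_)
    (discreteKL_nonneg (fun i => Finset.sum_nonneg fun j _ => hG i j) fun i => ?_))
    (discreteKL_nonneg (fun j => Finset.sum_nonneg fun i _ => hG i j) fun j => ?_)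
  · linarith [hφψ (x i) (y j)]
  · exact mul_pos (Real.exp_pos _) hμ
  · exact mul_pos (Real.exp_pos _) hν

theorem uot_oracleEmpirical_sub_eq_excessDecomposition {μ ν : Measure Ω} [IsFiniteMeasure μ]
    [IsFiniteMeasure ν] (hμ : μ ≠ 0) (hν : ν ≠ 0) (hn : 0 < n) (hm : 0 < m) (φ ψ : Ω →ᵇ ℝ)
    (x : Fin n → Ω) (y : Fin m → Ω) {G : Matrix (Fin n) (Fin m) ℝ}
    (hG : IsOptimalEmpiricalPlan μ ν x y G) :
    uot (oracleEmpirical μ x) (oracleEmpirical ν y)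
        - (∫ z, effective φ z ∂(oracleEmpirical μ x))
        - (∫ z, effective ψ z ∂(oracleEmpirical ν y))
      = excessDecomposition μ ν φ ψ x y G := by
  rw [excessDecomposition_eq μ ν (atomMass_pos hμ hn) (atomMass_pos hν hm) φ ψ x y hG.nonneg,
    integral_oracleEmpirical μ, integral_oracleEmpirical ν,
    oracleEmpirical_eq_atomic μ hn, oracleEmpirical_eq_atomic ν hm,
    uot_atomic_eq (atomMass_pos hμ hn) (atomMass_pos hν hm) x y hG]

end Reduction

/-! ### Kantorovich duality on compact spaces -/

section Compact

open CompactlySupported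

/-- The Riesz-Markov-Kakutani theorem for positive functionals on `C(Z, ℝ)`, `Z` compact. -/
theorem exists_measure_of_positive_functional {Z : Type*} [TopologicalSpace Z] [T2Space Z]
    [CompactSpace Z] [MeasurableSpace Z] [BorelSpace Z] (Λ : C(Z, ℝ) →ₗ[ℝ] ℝ)
    (hΛ : ∀ h : C(Z, ℝ), (∀ z, 0 ≤ h z) → 0 ≤ Λ h) :
    ∃ γ : Measure Z, IsFiniteMeasure γ ∧ ∀ h : C(Z, ℝ), ∫ z, h z ∂γ = Λ h := by
  let Λ' : C_c(Z, ℝ) →ₚ[ℝ] ℝ := PositiveLinearMap.mk₀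
    { toFun := fun h => Λ h.toContinuousMap
      map_add' := fun f g => Λ.map_add f.toContinuousMap g.toContinuousMap
      map_smul' := fun r f => Λ.map_smul r f.toContinuousMap }
    (fun h hh => hΛ _ fun z => hh z)
  exact ⟨RealRMK.rieszMeasure Λ', inferInstance, fun h =>
    RealRMK.integral_rieszMeasure Λ' (CompactlySupportedContinuousMap.continuousMapEquiv h)⟩

variable {X Y : Type*} [MetricSpace X] [CompactSpace X] [MeasurableSpace X] [BorelSpace X]
  [MetricSpace Y] [CompactSpace Y] [MeasurableSpace Y] [BorelSpace Y]

theorem integrable_continuousMap (α : Measure X) [IsFiniteMeasure α] (f : C(X, ℝ)) :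
    Integrable f α :=
  (BoundedContinuousFunction.mkOfCompact f).integrable α

/-- Elements of `(C(X) × C(Y)) × C(X × Y)` whose sum `φ ⊕ ψ + h` dominates a nonnegative multiple
of `v - c`. -/
def dominatingCone (c : C(X × Y, ℝ)) (v : ℝ) :
    PointedCone ℝ ((C(X, ℝ) × C(Y, ℝ)) × C(X × Y, ℝ)) where
  carrier := {p | ∃ s : ℝ, 0 ≤ s ∧
    ∀ x y, s * (v - c (x, y)) ≤ p.1.1 x + p.1.2 y + p.2 (x, y)}
  add_mem' := by
    rintro p q ⟨s, hs, hp⟩ ⟨t, ht, hq⟩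
    refine ⟨s + t, add_nonneg hs ht, fun x y => ?_⟩
    have h1 := hp x y
    have h2 := hq x y
    simp only [Prod.fst_add, Prod.snd_add, ContinuousMap.add_apply]
    linarith
  zero_mem' := ⟨0, le_rfl, fun x y => by simp⟩
  smul_mem' := by
    rintro r p ⟨s, hs, hp⟩
    refine ⟨r * s, mul_nonneg r.2 hs, fun x y => ?_⟩
    have h1 := mul_le_mul_of_nonneg_left (hp x y) r.2
    change _ ≤ (r : ℝ) * p.1.1 x + (r : ℝ) * p.1.2 y + (r : ℝ) * p.2 (x, y)
    linarith

/-- The functional `(φ, ψ, 0) ↦ ∫ φ dα + ∫ ψ dβ`. -/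
def marginalFunctional (α : Measure X) [IsFiniteMeasure α] (β : Measure Y) [IsFiniteMeasure β] :
    ((C(X, ℝ) × C(Y, ℝ)) × C(X × Y, ℝ)) →ₗ.[ℝ] ℝ where
  domain := LinearMap.ker (LinearMap.snd ℝ (C(X, ℝ) × C(Y, ℝ)) C(X × Y, ℝ))
  toFun :=
    { toFun := fun p => (∫ x, p.1.1.1 x ∂α) + ∫ y, p.1.1.2 y ∂β
      map_add' := fun p q => by
        have h1 := integral_add (integrable_continuousMap α p.1.1.1)
          (integrable_continuousMap α q.1.1.1)
        have h2 := integral_add (integrable_continuousMap β p.1.1.2)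
          (integrable_continuousMap β q.1.1.2)
        simp only [Submodule.coe_add, Prod.fst_add, Prod.snd_add, ContinuousMap.add_apply, h1, h2]
        ring
      map_smul' := fun r p => by
        simp only [Submodule.coe_smul, Prod.smul_fst, Prod.smul_snd, ContinuousMap.smul_apply,
          integral_smul, RingHom.id_apply, smul_add] }

/-- Positivity of `marginalFunctional` on `dominatingCone`, as the Riesz extension requires. For `s
> 0`, the pair `(V / α(X) - φ / s, -ψ / s)` is feasible, and the bound `V` gives the sign. For `s =
0`, the pairs `(-‖c‖ - kφ, -kψ)` are feasible for all `k`, so a negative value would violate the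
bound for large `k`. -/
theorem integral_add_integral_nonneg {X Y : Type*} [MetricSpace X] [CompactSpace X]
    [MeasurableSpace X] [BorelSpace X] [MetricSpace Y] [CompactSpace Y] [MeasurableSpace Y]
    {α : Measure X} [IsFiniteMeasure α] {β : Measure Y}
    [IsFiniteMeasure β] {c : C(X × Y, ℝ)} {V : ℝ} (hα : 0 < α.real Set.univ)
    (hV : ∀ (φ : C(X, ℝ)) (ψ : C(Y, ℝ)), (∀ x y, φ x + ψ y ≤ c (x, y)) →
      (∫ x, φ x ∂α) + ∫ y, ψ y ∂β ≤ V)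
    {φ : C(X, ℝ)} {ψ : C(Y, ℝ)} {s : ℝ} (hs : 0 ≤ s)
    (h : ∀ x y, s * (V / α.real Set.univ - c (x, y)) ≤ φ x + ψ y) :
    0 ≤ (∫ x, φ x ∂α) + ∫ y, ψ y ∂β := by
  have key : ∀ (t r : ℝ), (∀ x y, r - t * (φ x + ψ y) ≤ c (x, y)) →
      r * α.real Set.univ - t * ((∫ x, φ x ∂α) + ∫ y, ψ y ∂β) ≤ V := by
    intro t r hr
    have := hV (ContinuousMap.const X r - t • φ) (-(t • ψ)) fun x y => by
      have := hr x y
      simp only [ContinuousMap.sub_apply, ContinuousMap.const_apply, ContinuousMap.smul_apply,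
        ContinuousMap.neg_apply, smul_eq_mul]
      linarith
    simp only [ContinuousMap.sub_apply, ContinuousMap.const_apply, ContinuousMap.smul_apply,
      ContinuousMap.neg_apply, smul_eq_mul] at this
    rw [integral_sub (integrable_const _) ((integrable_continuousMap α φ).const_mul t),
      integral_neg, integral_const_mul, integral_const_mul, integral_const, smul_eq_mul] at this
    linarith
  rcases hs.eq_or_lt with rfl | hs
  · by_contra! hneg
    set I := (∫ x, φ x ∂α) + ∫ y, ψ y ∂β
    obtain ⟨k, hk⟩ := exists_nat_gt ((V + ‖c‖ * α.real Set.univ) / -I)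
    rw [div_lt_iff₀ (by linarith)] at hk
    have := key k (-‖c‖) fun x y => by
      have h1 := h x y
      rw [zero_mul] at h1
      have h2 := (abs_le.1 (c.norm_coe_le_norm (x, y))).1
      nlinarith [mul_nonneg k.cast_nonneg h1]
    linarith
  · have := key s⁻¹ (V / α.real Set.univ) fun x y => by
      have h1 := mul_le_mul_of_nonneg_left (h x y) (inv_nonneg.2 hs.le)
      rw [← mul_assoc, inv_mul_cancel₀ hs.ne', one_mul] at h1
      linarith
    rw [div_mul_cancel₀ _ hα.ne'] at this
    have h2 : 0 ≤ s⁻¹ * ((∫ x, φ x ∂α) + ∫ y, ψ y ∂β) := by linarith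
    exact (mul_nonneg_iff_of_pos_left (inv_pos.2 hs)).1 h2

/-- A bound for the Kantorovich dual problem on compact spaces is attained by some coupling. -/
theorem exists_coupling_integral_le (α : Measure X) [IsFiniteMeasure α] (β : Measure Y)
    [IsFiniteMeasure β] (hα : α ≠ 0) (c : C(X × Y, ℝ)) (V : ℝ)
    (hV : ∀ (φ : C(X, ℝ)) (ψ : C(Y, ℝ)), (∀ x y, φ x + ψ y ≤ c (x, y)) →
      (∫ x, φ x ∂α) + ∫ y, ψ y ∂β ≤ V) :
    ∃ γ : Measure (X × Y), IsFiniteMeasure γ ∧ γ.fst = α ∧ γ.snd = β ∧ ∫ z, c z ∂γ ≤ V := by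
  have : NeZero α := ⟨hα⟩
  have hM : 0 < α.real Set.univ := measureReal_univ_pos
  set v := V / α.real Set.univ with hv
  -- The second side condition holds because adding a large constant to `φ` moves any element into
  -- the cone.
  obtain ⟨g, hgf, hgpos⟩ := riesz_extension (dominatingCone c v) (marginalFunctional α β)
    (by
      rintro ⟨⟨⟨φ, ψ⟩, h⟩, hh⟩ ⟨s, hs, hp⟩
      have h0 : h = 0 := hh
      subst h0
      exact integral_add_integral_nonneg hM hV hs fun x y => by simpa using hp x y)
    (by
      rintro ⟨⟨φ, ψ⟩, h⟩
      refine ⟨⟨((ContinuousMap.const X (‖φ‖ + ‖ψ‖ + ‖h‖), 0), 0), rfl⟩, 0, le_rfl, fun x y => ?_⟩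
      have h1 := (abs_le.1 (φ.norm_coe_le_norm x)).1
      have h2 := (abs_le.1 (ψ.norm_coe_le_norm y)).1
      have h3 := (abs_le.1 (h.norm_coe_le_norm (x, y))).1
      simp
      linarith)
  have hg1 : ∀ (φ : C(X, ℝ)) (ψ : C(Y, ℝ)), g ((φ, ψ), 0) = (∫ x, φ x ∂α) + ∫ y, ψ y ∂β :=
    fun φ ψ => hgf ⟨((φ, ψ), 0), rfl⟩
  -- Both `((-φ, -ψ), φ ⊕ ψ)` and its negative lie in the cone with `s = 0`, so `g` prescribes the
  -- marginals. Equality of the masses of `α` and `β` is thus a consequence of the bound `hV`.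
  have hg2 : ∀ (φ : C(X, ℝ)) (ψ : C(Y, ℝ)) (h : C(X × Y, ℝ)),
      (∀ x y, h (x, y) = φ x + ψ y) → g (0, h) = (∫ x, φ x ∂α) + ∫ y, ψ y ∂β := by
    intro φ ψ h hh
    have h1 : 0 ≤ g ((-φ, -ψ), h) := hgpos _ ⟨0, le_rfl, fun x y => by simp [hh]; linarith⟩
    have h2 : 0 ≤ g ((φ, ψ), -h) := hgpos _ ⟨0, le_rfl, fun x y => by simp [hh]⟩
    have e1 : (((-φ, -ψ), h) : (C(X, ℝ) × C(Y, ℝ)) × C(X × Y, ℝ)) = (0, h) - ((φ, ψ), 0) := by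
      simp
    have e2 : (((φ, ψ), -h) : (C(X, ℝ) × C(Y, ℝ)) × C(X × Y, ℝ)) = ((φ, ψ), 0) - (0, h) := by
      simp
    rw [e1, map_sub, hg1] at h1
    rw [e2, map_sub, hg1] at h2
    linarith
  obtain ⟨γ, hγ, hγg⟩ := exists_measure_of_positive_functional
    (g.comp (LinearMap.inr ℝ (C(X, ℝ) × C(Y, ℝ)) C(X × Y, ℝ)))
    (fun h hh => hgpos _ ⟨0, le_rfl, fun x y => by simpa using hh (x, y)⟩)
  have hγg' : ∀ h : C(X × Y, ℝ), ∫ z, h z ∂γ = g (0, h) := fun h => hγg h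
  refine ⟨γ, hγ, ?_, ?_, ?_⟩
  · refine ext_of_forall_integral_eq_of_IsFiniteMeasure fun f => ?_
    rw [Measure.fst, integral_map (by fun_prop) (by fun_prop)]
    have := hγg' (f.toContinuousMap.comp ⟨Prod.fst, continuous_fst⟩)
    rw [hg2 f.toContinuousMap 0 _ fun x y => by simp] at this
    simpa using this
  · refine ext_of_forall_integral_eq_of_IsFiniteMeasure fun f => ?_
    rw [Measure.snd, integral_map (by fun_prop) (by fun_prop)]
    have := hγg' (f.toContinuousMap.comp ⟨Prod.snd, continuous_snd⟩)
    rw [hg2 0 f.toContinuousMap _ fun x y => by simp] at this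
    simpa using this
  · have h1 : 0 ≤ g (0, ContinuousMap.const (X × Y) v - c) :=
      hgpos _ ⟨1, zero_le_one, fun x y => by simp⟩
    have e1 : ((0, ContinuousMap.const (X × Y) v - c) : (C(X, ℝ) × C(Y, ℝ)) × C(X × Y, ℝ))
        = (0, ContinuousMap.const (X × Y) v) - (0, c) := by simp
    rw [e1, map_sub, hg2 (ContinuousMap.const X v) 0 _ fun x y => by simp, ← hγg' c] at h1
    simp only [ContinuousMap.const_apply, integral_const, smul_eq_mul] at h1
    have hz : ∫ y, (0 : C(Y, ℝ)) y ∂β = 0 := by simp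
    rw [hv, mul_div_cancel₀ _ hM.ne', hz] at h1
    linarith

end Compact

/-! ### Strong duality -/

section Duality

variable {d : ℕ} {Ω : Set (EuclideanSpace ℝ (Fin d))}

theorem continuous_exp_neg (φ : Ω →ᵇ ℝ) : Continuous fun x => Real.exp (-φ x) := by fun_prop

theorem exp_neg_le (φ : Ω →ᵇ ℝ) (x : Ω) : Real.exp (-φ x) ≤ Real.exp ‖φ‖ :=
  Real.exp_le_exp.2 (by linarith [(abs_le.1 (φ.norm_coe_le_norm x)).1])

theorem integrable_of_continuous_of_bound {μ : Measure Ω} [IsFiniteMeasure μ] {f : Ω → ℝ}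
    (hf : Continuous f) (C : ℝ) (hC : ∀ x, |f x| ≤ C) : Integrable f μ :=
  Integrable.of_bound hf.aestronglyMeasurable C (ae_of_all _ hC)

theorem integrable_exp_neg (μ : Measure Ω) [IsFiniteMeasure μ] (φ : Ω →ᵇ ℝ) :
    Integrable (fun x => Real.exp (-φ x)) μ :=
  integrable_of_continuous_of_bound (continuous_exp_neg φ) (Real.exp ‖φ‖) fun x => by
    rw [abs_of_pos (Real.exp_pos _)]
    exact exp_neg_le φ x

theorem integrable_mul_exp_neg (μ : Measure Ω) [IsFiniteMeasure μ] (u φ : Ω →ᵇ ℝ) :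
    Integrable (fun x => u x * Real.exp (-φ x)) μ :=
  integrable_of_continuous_of_bound (by fun_prop) (‖u‖ * Real.exp ‖φ‖) fun x => by
    rw [abs_mul, abs_of_pos (Real.exp_pos _)]
    exact mul_le_mul (u.norm_coe_le_norm x) (exp_neg_le φ x) (Real.exp_pos _).le (norm_nonneg _)

theorem integrable_one_sub_exp_neg (μ : Measure Ω) [IsFiniteMeasure μ] (φ : Ω →ᵇ ℝ) :
    Integrable (fun x => 1 - Real.exp (-φ x)) μ :=
  (integrable_const 1).sub (integrable_exp_neg μ φ)

/-- Second-order lower bound for `t ↦ ∫ (1 - e^{-(φ + t u)}) dμ`. -/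
theorem integral_one_sub_exp_neg_add_smul_ge (μ : Measure Ω) [IsFiniteMeasure μ] (φ u : Ω →ᵇ ℝ)
    {t : ℝ} (ht : 0 ≤ t) (htu : t * ‖u‖ ≤ 1) :
    (∫ x, (1 - Real.exp (-φ x)) ∂μ) + t * (∫ x, u x * Real.exp (-φ x) ∂μ)
        - t ^ 2 * (‖u‖ ^ 2 * ∫ x, Real.exp (-φ x) ∂μ)
      ≤ ∫ x, (1 - Real.exp (-(φ + t • u) x)) ∂μ := by
  have i1 : Integrable (fun x => (1 - Real.exp (-φ x)) + t * (u x * Real.exp (-φ x))) μ :=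
    (integrable_one_sub_exp_neg μ φ).add ((integrable_mul_exp_neg μ u φ).const_mul t)
  have i2 : Integrable (fun x => t ^ 2 * (‖u‖ ^ 2 * Real.exp (-φ x))) μ :=
    ((integrable_exp_neg μ φ).const_mul _).const_mul _
  rw [← integral_const_mul, ← integral_const_mul (‖u‖ ^ 2), ← integral_const_mul (t ^ 2),
    ← integral_add (integrable_one_sub_exp_neg μ φ) ((integrable_mul_exp_neg μ u φ).const_mul t),
    ← integral_sub i1 i2]
  refine integral_mono (i1.sub i2) (integrable_one_sub_exp_neg μ _) fun x => ?_
  have hu : |u x| ≤ ‖u‖ := u.norm_coe_le_norm x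
  have hx : |-(t * u x)| ≤ 1 := by
    rw [abs_neg, abs_mul, abs_of_nonneg ht]
    exact (mul_le_mul_of_nonneg_left hu ht).trans htu
  have h1 := (abs_le.1 (Real.abs_exp_sub_one_sub_id_le hx)).2
  have h2 : (t * u x) ^ 2 ≤ t ^ 2 * ‖u‖ ^ 2 := by
    rw [mul_pow]
    exact mul_le_mul_of_nonneg_left (sq_le_sq' (abs_le.1 hu).1 (abs_le.1 hu).2) (sq_nonneg t)
  have h3 : Real.exp (-(φ + t • u) x) = Real.exp (-φ x) * Real.exp (-(t * u x)) := by
    rw [← Real.exp_add]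
    congr 1
    simp
    ring
  have h4 : Real.exp (-(t * u x)) ≤ 1 - t * u x + t ^ 2 * ‖u‖ ^ 2 := by
    rw [neg_sq] at h1
    linarith
  have h5 := mul_le_mul_of_nonneg_left h4 (Real.exp_pos (-φ x)).le
  simp only [h3]
  linarith

/-- First-order optimality: `(φ₀, ψ₀)` maximizes the Kantorovich dual functional of the active
marginals `e^{-φ₀} μ` and `e^{-ψ₀} ν`. -/
theorem IsOptimalDualPair.integral_mul_exp_neg_le {μ ν : Measure Ω} [IsFiniteMeasure μ]
    [IsFiniteMeasure ν] {φ₀ ψ₀ : Ω →ᵇ ℝ} (h : IsOptimalDualPair μ ν φ₀ ψ₀) {φ ψ : Ω →ᵇ ℝ}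
    (hφψ : DualFeasible φ ψ) :
    (∫ x, φ x * Real.exp (-φ₀ x) ∂μ) + ∫ y, ψ y * Real.exp (-ψ₀ y) ∂ν
      ≤ (∫ x, φ₀ x * Real.exp (-φ₀ x) ∂μ) + ∫ y, ψ₀ y * Real.exp (-ψ₀ y) ∂ν := by
  set u := φ - φ₀ with hu
  set w := ψ - ψ₀ with hw
  have e1 : ∫ x, u x * Real.exp (-φ₀ x) ∂μ
      = (∫ x, φ x * Real.exp (-φ₀ x) ∂μ) - ∫ x, φ₀ x * Real.exp (-φ₀ x) ∂μ := by
    rw [← integral_sub (integrable_mul_exp_neg μ φ φ₀) (integrable_mul_exp_neg μ φ₀ φ₀)]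
    simp [hu, sub_mul]
  have e2 : ∫ x, w x * Real.exp (-ψ₀ x) ∂ν
      = (∫ x, ψ x * Real.exp (-ψ₀ x) ∂ν) - ∫ x, ψ₀ x * Real.exp (-ψ₀ x) ∂ν := by
    rw [← integral_sub (integrable_mul_exp_neg ν ψ ψ₀) (integrable_mul_exp_neg ν ψ₀ ψ₀)]
    simp [hw, sub_mul]
  set A := ∫ x, u x * Real.exp (-φ₀ x) ∂μ
  set B := ∫ x, w x * Real.exp (-ψ₀ x) ∂ν
  set K := ‖u‖ ^ 2 * (∫ x, Real.exp (-φ₀ x) ∂μ) + ‖w‖ ^ 2 * ∫ x, Real.exp (-ψ₀ x) ∂ν with hK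
  have hK0 : 0 ≤ K := add_nonneg
    (mul_nonneg (sq_nonneg _) (integral_nonneg fun x => (Real.exp_pos _).le))
    (mul_nonneg (sq_nonneg _) (integral_nonneg fun x => (Real.exp_pos _).le))
  -- Feasible pairs form a convex set, so optimality can be tested along the segment towards `(φ,
  -- ψ)`; `K` bounds the second-order error.
  have key : ∀ t : ℝ, 0 < t → t ≤ 1 → t * ‖u‖ ≤ 1 → t * ‖w‖ ≤ 1 → A + B ≤ t * K := by
    intro t ht ht1 htu htw
    have hf : DualFeasible (φ₀ + t • u) (ψ₀ + t • w) := fun x y => by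
      have h1 := mul_le_mul_of_nonneg_left (hφψ x y) ht.le
      have h2 := mul_le_mul_of_nonneg_left (h.feasible x y) (sub_nonneg.2 ht1)
      simp only [hu, hw, BoundedContinuousFunction.add_apply, BoundedContinuousFunction.smul_apply,
        BoundedContinuousFunction.sub_apply, smul_eq_mul]
      linarith
    have h1 := h.optimal _ _ hf
    have h2 := integral_one_sub_exp_neg_add_smul_ge μ φ₀ u ht.le htu
    have h3 := integral_one_sub_exp_neg_add_smul_ge ν ψ₀ w ht.le htw
    unfold dualObjective at h1
    have h4 : t * (A + B) ≤ t * (t * K) := by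
      rw [hK]
      linarith
    exact le_of_mul_le_mul_left h4 ht
  have hAB : A + B ≤ 0 := by
    by_contra! hpos
    have hd : 0 < 1 + ‖u‖ + ‖w‖ + 2 * K / (A + B) := by positivity
    -- Small enough for `key`, and with `2 t K ≤ A + B`, which contradicts `0 < A + B ≤ t K`.
    set t := (1 + ‖u‖ + ‖w‖ + 2 * K / (A + B))⁻¹ with ht
    have htpos : 0 < t := inv_pos.2 hd
    have hle : ∀ r, r ≤ 1 + ‖u‖ + ‖w‖ + 2 * K / (A + B) → t * r ≤ 1 := fun r hr => by
      rw [ht, inv_mul_le_iff₀ hd]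
      linarith
    have hq : 0 ≤ 2 * K / (A + B) := by positivity
    have hu0 := norm_nonneg u
    have hw0 := norm_nonneg w
    have h1 := key t htpos (by simpa using hle 1 (by linarith)) (hle _ (by linarith))
      (hle _ (by linarith))
    have h2 := mul_le_mul_of_nonneg_right (hle (2 * K / (A + B)) (by linarith)) hpos.le
    rw [mul_assoc, div_mul_cancel₀ _ hpos.ne'] at h2
    linarith
  linarith

/-- The active marginal `e^{-φ} μ`. -/
def activeMeasure (μ : Measure Ω) (φ : Ω →ᵇ ℝ) : Measure Ω :=
  μ.withDensity fun x => ENNReal.ofReal (Real.exp (-φ x))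

theorem measurable_activeDensity (φ : Ω →ᵇ ℝ) :
    Measurable fun x : Ω => ENNReal.ofReal (Real.exp (-φ x)) :=
  (continuous_exp_neg φ).measurable.ennreal_ofReal

instance (μ : Measure Ω) [IsFiniteMeasure μ] (φ : Ω →ᵇ ℝ) :
    IsFiniteMeasure (activeMeasure μ φ) :=
  isFiniteMeasure_withDensity_ofReal (integrable_exp_neg μ φ).2

theorem activeMeasure_ne_zero {μ : Measure Ω} (hμ : μ ≠ 0) (φ : Ω →ᵇ ℝ) :
    activeMeasure μ φ ≠ 0 := by
  intro h
  rw [activeMeasure, withDensity_eq_zero_iff (measurable_activeDensity φ).aemeasurable] at h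
  have : ∀ᵐ x ∂μ, False := by
    filter_upwards [h] with x hx
    simp only [Pi.zero_apply, ENNReal.ofReal_eq_zero] at hx
    exact absurd hx (not_le.2 (Real.exp_pos _))
  simp at this
  exact hμ this

theorem integral_activeMeasure (μ : Measure Ω) (φ : Ω →ᵇ ℝ) (f : Ω → ℝ) :
    ∫ x, f x ∂(activeMeasure μ φ) = ∫ x, f x * Real.exp (-φ x) ∂μ := by
  rw [activeMeasure, integral_withDensity_eq_integral_toReal_smul (measurable_activeDensity φ)
    (ae_of_all _ fun x => ENNReal.ofReal_lt_top)]
  refine integral_congr_ae (ae_of_all _ fun x => ?_)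
  simp [ENNReal.toReal_ofReal (Real.exp_pos _).le, mul_comm]

theorem klFun_exp_neg (t : ℝ) :
    klFun (Real.exp (-t)) = (1 - Real.exp (-t)) - t * Real.exp (-t) := by
  rw [klFun_apply, Real.log_exp]
  ring

theorem klDiv_activeMeasure (μ : Measure Ω) [IsFiniteMeasure μ] (φ : Ω →ᵇ ℝ) :
    klDiv (activeMeasure μ φ) μ = ENNReal.ofReal
      ((∫ x, (1 - Real.exp (-φ x)) ∂μ) - ∫ x, φ x * Real.exp (-φ x) ∂μ) := by
  have : IsFiniteMeasure (μ.withDensity fun x => ENNReal.ofReal (Real.exp (-φ x))) :=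
    inferInstanceAs (IsFiniteMeasure (activeMeasure μ φ))
  have hi : Integrable (fun x => (1 - Real.exp (-φ x)) - φ x * Real.exp (-φ x)) μ :=
    (integrable_one_sub_exp_neg μ φ).sub (integrable_mul_exp_neg μ φ φ)
  rw [activeMeasure, klDiv_withDensity μ (measurable_activeDensity φ),
    ← integral_sub (integrable_one_sub_exp_neg μ φ) (integrable_mul_exp_neg μ φ φ),
    ofReal_integral_eq_lintegral_ofReal hi (ae_of_all _ fun x => by
      simp only [Pi.zero_apply, ← klFun_exp_neg]
      exact klFun_nonneg (Real.exp_pos _).le)]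
  refine lintegral_congr fun x => ?_
  rw [ENNReal.toReal_ofReal (Real.exp_pos _).le, klFun_exp_neg]

/-- Kantorovich duality on a bounded Borel set: a dual bound is attained by some coupling. -/
theorem exists_coupling_of_isBounded (hΩb : Bornology.IsBounded Ω) (hΩm : MeasurableSet Ω)
    (α β : Measure Ω) [IsFiniteMeasure α] [IsFiniteMeasure β] (hα : α ≠ 0) (V : ℝ)
    (hV : ∀ φ ψ : Ω →ᵇ ℝ, DualFeasible φ ψ → (∫ x, φ x ∂α) + ∫ y, ψ y ∂β ≤ V) :
    ∃ γ : Measure (Ω × Ω), IsFiniteMeasure γ ∧ γ.fst = α ∧ γ.snd = β ∧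
      ∫⁻ z, ENNReal.ofReal (cost (z.1 : EuclideanSpace ℝ (Fin d)) z.2) ∂γ ≤ ENNReal.ofReal V := by
  -- `Ω` need not be closed, so duality is applied on its compact closure. Dual pairs restrict to
  -- `Ω`; the coupling has marginals carried by the Borel image of `Ω`, hence pulls back.
  let K := closure Ω
  have : CompactSpace K := isCompact_iff_compactSpace.1 hΩb.isCompact_closure
  have : StandardBorelSpace Ω := hΩm.standardBorel
  let ι : Ω → K := Set.inclusion subset_closure
  have hιc : Continuous ι := continuous_inclusion subset_closure
  have hιi : Function.Injective ι := Set.inclusion_injective subset_closure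
  have hι : MeasurableEmbedding ι := hιc.measurable.measurableEmbedding hιi
  have hj : MeasurableEmbedding (Prod.map ι ι) :=
    (hιc.measurable.prodMap hιc.measurable).measurableEmbedding (hιi.prodMap hιi)
  let c : C(K × K, ℝ) := ⟨fun z => cost (z.1 : EuclideanSpace ℝ (Fin d)) z.2, by fun_prop⟩
  obtain ⟨γ, hγ, hγ1, hγ2, hγV⟩ := exists_coupling_integral_le (α.map ι) (β.map ι)
    (by rwa [ne_eq, Measure.map_eq_zero_iff hιc.aemeasurable]) c V (by
      intro φ ψ hφψ
      rw [integral_map hιc.aemeasurable (by fun_prop), integral_map hιc.aemeasurable (by fun_prop)]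
      exact hV ((BoundedContinuousFunction.mkOfCompact φ).compContinuous ⟨ι, hιc⟩)
        ((BoundedContinuousFunction.mkOfCompact ψ).compContinuous ⟨ι, hιc⟩)
        fun x y => hφψ (ι x) (ι y))
  have hnull : γ (Set.range (Prod.map ι ι))ᶜ = 0 := by
    have h1 : γ (Prod.fst ⁻¹' (Set.range ι)ᶜ) = 0 := by
      rw [← Measure.fst_apply hι.measurableSet_range.compl, hγ1,
        Measure.map_apply hιc.measurable hι.measurableSet_range.compl]
      simp
    have h2 : γ (Prod.snd ⁻¹' (Set.range ι)ᶜ) = 0 := by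
      rw [← Measure.snd_apply hι.measurableSet_range.compl, hγ2,
        Measure.map_apply hιc.measurable hι.measurableSet_range.compl]
      simp
    refine measure_mono_null (fun z hz => ?_) (measure_union_null h1 h2)
    rw [Set.range_prodMap, Set.mem_compl_iff, Set.mem_prod, not_and_or] at hz
    exact hz
  have hmap : (γ.comap (Prod.map ι ι)).map (Prod.map ι ι) = γ := by
    rw [hj.map_comap, Measure.restrict_eq_self_of_ae_mem]
    exact hnull
  set γ' := γ.comap (Prod.map ι ι) with hγ'
  have hfin : IsFiniteMeasure γ' := by
    constructor
    have : γ' Set.univ = γ Set.univ := by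
      conv_rhs => rw [← hmap]
      rw [Measure.map_apply hj.measurable MeasurableSet.univ, Set.preimage_univ]
    rw [this]
    exact measure_lt_top _ _
  have hinj : ∀ η₁ η₂ : Measure Ω, η₁.map ι = η₂.map ι → η₁ = η₂ := fun η₁ η₂ h => by
    rw [← hι.comap_map η₁, h, hι.comap_map]
  refine ⟨γ', hfin, hinj _ _ ?_, hinj _ _ ?_, ?_⟩
  · rw [← hγ1]
    conv_rhs => rw [← hmap]
    rw [Measure.fst, Measure.fst, Measure.map_map hιc.measurable measurable_fst,
      Measure.map_map measurable_fst hj.measurable]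
    rfl
  · rw [← hγ2]
    conv_rhs => rw [← hmap]
    rw [Measure.snd, Measure.snd, Measure.map_map hιc.measurable measurable_snd,
      Measure.map_map measurable_snd hj.measurable]
    rfl
  · calc ∫⁻ z, ENNReal.ofReal (cost (z.1 : EuclideanSpace ℝ (Fin d)) z.2) ∂γ'
        = ∫⁻ z, ENNReal.ofReal (c z) ∂γ := by
          conv_rhs => rw [← hmap]
          rw [hj.lintegral_map]
          rfl
      _ = ENNReal.ofReal (∫ z, c z ∂γ) :=
          (ofReal_integral_eq_lintegral_ofReal (integrable_continuousMap γ c)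
            (ae_of_all _ fun z => cost_nonneg _ _)).symm
      _ ≤ ENNReal.ofReal V := ENNReal.ofReal_le_ofReal hγV

theorem IsOptimalDualPair.dualObjective_nonneg {μ ν : Measure Ω} {φ₀ ψ₀ : Ω →ᵇ ℝ}
    (h : IsOptimalDualPair μ ν φ₀ ψ₀) : 0 ≤ dualObjective μ ν φ₀ ψ₀ := by
  have := h.optimal 0 0 fun x y => by simpa using cost_nonneg _ _
  simpa [dualObjective] using this

/-- A coupling of the active marginals has cost at most `V`. By `klFun_exp_neg` its KL terms equal
the dual objective minus `V`, so `V` cancels. -/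
theorem IsOptimalDualPair.uot_le_dualObjective (hΩb : Bornology.IsBounded Ω)
    (hΩm : MeasurableSet Ω) {μ ν : Measure Ω} [IsFiniteMeasure μ] [IsFiniteMeasure ν] (hμ : μ ≠ 0)
    {φ₀ ψ₀ : Ω →ᵇ ℝ} (h : IsOptimalDualPair μ ν φ₀ ψ₀) :
    uot μ ν ≤ dualObjective μ ν φ₀ ψ₀ := by
  set V := (∫ x, φ₀ x * Real.exp (-φ₀ x) ∂μ) + ∫ y, ψ₀ y * Real.exp (-ψ₀ y) ∂ν with hVdef
  have hV : ∀ φ ψ : Ω →ᵇ ℝ, DualFeasible φ ψ →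
      (∫ x, φ x ∂(activeMeasure μ φ₀)) + ∫ y, ψ y ∂(activeMeasure ν ψ₀) ≤ V := fun φ ψ hφψ => by
    rw [integral_activeMeasure, integral_activeMeasure]
    exact h.integral_mul_exp_neg_le hφψ
  obtain ⟨γ, hγ, hγ1, hγ2, hγV⟩ := exists_coupling_of_isBounded hΩb hΩm (activeMeasure μ φ₀)
    (activeMeasure ν ψ₀) (activeMeasure_ne_zero hμ φ₀) V hV
  refine ENNReal.toReal_le_of_le_ofReal h.dualObjective_nonneg ?_
  refine (iInf_le _ (⟨γ, hγ⟩ : FiniteMeasure (Ω × Ω))).trans ?_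
  change (∫⁻ z, ENNReal.ofReal (cost (z.1 : EuclideanSpace ℝ (Fin d)) z.2) ∂γ)
    + klDiv γ.fst μ + klDiv γ.snd ν ≤ _
  rw [hγ1, hγ2]
  refine (add_le_add (add_le_add hγV le_rfl) le_rfl).trans ?_
  have hV0 : 0 ≤ V := by
    have := hV 0 0 fun x y => by simpa using cost_nonneg _ _
    simpa using this
  have hnn : ∀ (σ : Measure Ω) [IsFiniteMeasure σ] (φ : Ω →ᵇ ℝ),
      0 ≤ (∫ x, (1 - Real.exp (-φ x)) ∂σ) - ∫ x, φ x * Real.exp (-φ x) ∂σ := by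
    intro σ _ φ
    rw [← integral_sub (integrable_one_sub_exp_neg σ φ) (integrable_mul_exp_neg σ φ φ)]
    refine integral_nonneg fun x => ?_
    simp only [Pi.zero_apply, ← klFun_exp_neg]
    exact klFun_nonneg (Real.exp_pos _).le
  rw [klDiv_activeMeasure, klDiv_activeMeasure, ← ENNReal.ofReal_add hV0 (hnn μ φ₀),
    ← ENNReal.ofReal_add (add_nonneg hV0 (hnn μ φ₀)) (hnn ν ψ₀)]
  refine ENNReal.ofReal_le_ofReal (le_of_eq ?_)
  rw [hVdef, dualObjective]
  ring

/-- Integrated Fenchel-Young inequality `1 - e^{-t} ≤ F(r) + r t`, with `r` the density `dη/dμ`. -/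
theorem integral_one_sub_exp_neg_le (μ η : Measure Ω) [IsFiniteMeasure μ] [IsFiniteMeasure η]
    (h : klDiv η μ ≠ ∞) (φ : Ω →ᵇ ℝ) :
    ∫ x, (1 - Real.exp (-φ x)) ∂μ ≤ (klDiv η μ).toReal + ∫ x, φ x ∂η := by
  obtain ⟨hac, hint⟩ := klDiv_ne_top_iff.1 h
  have h1 : Integrable (fun x => klFun (η.rnDeriv μ x).toReal) μ :=
    (integrable_klFun_rnDeriv_iff hac).2 hint
  have h2 : Integrable (fun x => (η.rnDeriv μ x).toReal • φ x) μ :=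
    (integrable_rnDeriv_smul_iff hac).2 (φ.integrable η)
  rw [toReal_klDiv_eq_integral_klFun hac, ← integral_rnDeriv_smul hac, ← integral_add h1 h2]
  refine integral_mono (integrable_one_sub_exp_neg μ φ) (h1.add h2) fun x => ?_
  have h3 := mul_klFun_div_exp_mul one_pos (ENNReal.toReal_nonneg (a := η.rnDeriv μ x)) (φ x)
  have h4 : 0 ≤ Real.exp (-φ x) * 1
      * klFun ((η.rnDeriv μ x).toReal / (Real.exp (-φ x) * 1)) :=
    mul_nonneg (by positivity) (klFun_nonneg (by positivity))
  simp only [div_one, one_mul] at h3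
  simp only [smul_eq_mul]
  linarith

theorem dualObjective_le_uot {μ ν : Measure Ω} [IsFiniteMeasure μ] [IsFiniteMeasure ν]
    {φ ψ : Ω →ᵇ ℝ} (h : DualFeasible φ ψ) : dualObjective μ ν φ ψ ≤ uot μ ν := by
  refine (ENNReal.ofReal_le_iff_le_toReal (uotENNReal_ne_top μ ν)).1 (le_iInf fun γ => ?_)
  set γ' : Measure (Ω × Ω) := (γ : Measure (Ω × Ω))
  by_cases htop : primalObjective μ ν γ' = ∞
  · rw [htop]; exact le_top
  refine (ENNReal.ofReal_le_iff_le_toReal htop).2 ?_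
  unfold primalObjective at htop ⊢
  simp only [ENNReal.add_eq_top, not_or] at htop
  obtain ⟨⟨hc, h1⟩, h2⟩ := htop
  rw [ENNReal.toReal_add (ENNReal.add_ne_top.2 ⟨hc, h1⟩) h2, ENNReal.toReal_add hc h1]
  have k1 := integral_one_sub_exp_neg_le μ γ'.fst h1 φ
  have k2 := integral_one_sub_exp_neg_le ν γ'.snd h2 ψ
  have hcm : Continuous fun z : Ω × Ω => cost (z.1 : EuclideanSpace ℝ (Fin d)) z.2 := by fun_prop
  have hci : Integrable (fun z : Ω × Ω => cost (z.1 : EuclideanSpace ℝ (Fin d)) z.2) γ' :=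
    (lintegral_ofReal_ne_top_iff_integrable hcm.aestronglyMeasurable
      (ae_of_all _ fun z => cost_nonneg _ _)).1 hc
  rw [Measure.fst, integral_map (by fun_prop) (by fun_prop)] at k1
  rw [Measure.snd, integral_map (by fun_prop) (by fun_prop)] at k2
  have i1 : Integrable (fun z : Ω × Ω => φ z.1) γ' :=
    (φ.compContinuous ⟨Prod.fst, continuous_fst⟩).integrable γ'
  have i2 : Integrable (fun z : Ω × Ω => ψ z.2) γ' :=
    (ψ.compContinuous ⟨Prod.snd, continuous_snd⟩).integrable γ'
  have k3 : (∫ z, φ z.1 ∂γ') + ∫ z, ψ z.2 ∂γ'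
      ≤ (∫⁻ z, ENNReal.ofReal (cost (z.1 : EuclideanSpace ℝ (Fin d)) z.2) ∂γ').toReal := by
    rw [← integral_add i1 i2, ← integral_eq_lintegral_of_nonneg_ae
      (ae_of_all _ fun z => cost_nonneg _ _) hcm.aestronglyMeasurable]
    exact integral_mono (i1.add i2) hci fun z => h z.1 z.2
  unfold dualObjective
  simp only [Measure.fst, Measure.snd] at k1 k2 ⊢
  linarith

theorem IsOptimalDualPair.uot_eq_dualObjective (hΩb : Bornology.IsBounded Ω)
    (hΩm : MeasurableSet Ω) {μ ν : Measure Ω} [IsFiniteMeasure μ] [IsFiniteMeasure ν] (hμ : μ ≠ 0)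
    {φ₀ ψ₀ : Ω →ᵇ ℝ} (h : IsOptimalDualPair μ ν φ₀ ψ₀) :
    uot μ ν = dualObjective μ ν φ₀ ψ₀ :=
  (h.uot_le_dualObjective hΩb hΩm hμ).antisymm (dualObjective_le_uot h.feasible)

end Duality

/-! ### Random samples -/

section Sampling

variable {d : ℕ} {Ω : Set (EuclideanSpace ℝ (Fin d))} {n m : ℕ}

theorem effective_eq (φ : Ω →ᵇ ℝ) : effective φ = fun x => 1 - Real.exp (-φ x) := by
  ext x
  rw [effective]
  ring

theorem integrable_effective (μ : Measure Ω) [IsFiniteMeasure μ] (φ : Ω →ᵇ ℝ) :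
    Integrable (effective φ) μ :=
  effective_eq φ ▸ integrable_one_sub_exp_neg μ φ

instance (μ : Measure Ω) [IsFiniteMeasure μ] : IsFiniteMeasure (normalized μ) := by
  rcases eq_or_ne μ 0 with rfl | hμ
  · rw [normalized, smul_zero]
    infer_instance
  · exact Measure.smul_finite μ (ENNReal.inv_ne_top.2 (by simpa using hμ))

variable {S : Type*} [MeasurableSpace S] {P : Measure S} {μ ν : Measure Ω} [IsFiniteMeasure μ]
  [IsFiniteMeasure ν] {X : Fin n → S → Ω} {Y : Fin m → S → Ω}

theorem integrable_integral_effective_oracleEmpirical (hX : ∀ i, HasLaw (X i) (normalized μ) P)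
    (φ : Ω →ᵇ ℝ) :
    Integrable (fun ω => ∫ z, effective φ z ∂(oracleEmpirical μ fun i => X i ω)) P := by
  simp_rw [integral_oracleEmpirical]
  refine integrable_finsetSum _ fun i _ => Integrable.const_mul ?_ _
  have := integrable_effective (normalized μ) φ
  rw [← (hX i).map_eq] at this
  exact this.comp_aemeasurable (hX i).aemeasurable

/-- Each of the `n` atoms of mass `M / n` contributes a mean `M⁻¹ ∫ effective φ dμ`; the masses
cancel. -/
theorem integral_integral_effective_oracleEmpirical (hμ : μ ≠ 0) (hn : 0 < n)
    (hX : ∀ i, HasLaw (X i) (normalized μ) P) (φ : Ω →ᵇ ℝ) :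
    ∫ ω, ∫ z, effective φ z ∂(oracleEmpirical μ fun i => X i ω) ∂P = ∫ z, effective φ z ∂μ := by
  have hi : ∀ i, Integrable (fun ω => effective φ (X i ω)) P := fun i => by
    have := integrable_effective (normalized μ) φ
    rw [← (hX i).map_eq] at this
    exact this.comp_aemeasurable (hX i).aemeasurable
  have hI : ∀ i, ∫ ω, effective φ (X i ω) ∂P = (μ.real Set.univ)⁻¹ * ∫ z, effective φ z ∂μ := by
    intro i
    have := (hX i).integral_comp (integrable_effective (normalized μ) φ).aestronglyMeasurable
    simp only [Function.comp_def] at this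
    rw [this, normalized, integral_smul_measure, ENNReal.toReal_inv, smul_eq_mul]
    rfl
  simp_rw [integral_oracleEmpirical]
  rw [integral_finsetSum _ fun i _ => (hi i).const_mul _]
  simp_rw [integral_const_mul, hI]
  have : NeZero μ := ⟨hμ⟩
  have hM : μ.real Set.univ ≠ 0 := measureReal_univ_pos.ne'
  have hn' : (n : ℝ) ≠ 0 := by exact_mod_cast hn.ne'
  rw [Finset.sum_const, Finset.card_univ, Fintype.card_fin, nsmul_eq_mul, atomMass]
  field_simp

/-- The zero plan bounds the cost by the sum of the total masses, which does not depend on the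
sample. -/
theorem integrable_uot_oracleEmpirical [IsProbabilityMeasure P] (hμ : μ ≠ 0) (hν : ν ≠ 0)
    (hn : 0 < n) (hm : 0 < m) (hX : ∀ i, AEMeasurable (X i) P) (hY : ∀ j, AEMeasurable (Y j) P) :
    Integrable (fun ω => uot (oracleEmpirical μ fun i => X i ω) (oracleEmpirical ν fun j => Y j ω))
      P := by
  simp_rw [oracleEmpirical_eq_atomic μ hn, oracleEmpirical_eq_atomic ν hm]
  have hmeas : AEMeasurable (fun ω => ((fun i => X i ω), fun j => Y j ω)) P :=
    (aemeasurable_pi_lambda _ hX).prodMk (aemeasurable_pi_lambda _ hY)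
  refine Integrable.of_bound ((measurable_uot_atomic (atomMass_pos hμ hn)
    (atomMass_pos hν hm)).comp_aemeasurable hmeas).aestronglyMeasurable
    (n * atomMass μ n + m * atomMass ν m) (ae_of_all _ fun ω => ?_)
  have hmass : ∀ {k : ℕ} {a : ℝ}, 0 < a → ∀ x : Fin k → Ω,
      (atomic (fun _ => a) x).real Set.univ = k * a := by
    intro k a ha x
    rw [Measure.real, atomic_apply _ _ MeasurableSet.univ]
    simp [ha.le]
  rw [Real.norm_of_nonneg (uot_nonneg _ _)]
  refine (uot_le _ _).trans (le_of_eq ?_)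
  rw [hmass (atomMass_pos hμ hn), hmass (atomMass_pos hν hm)]

end Sampling

end UOT

end

/-! ### The excess identity, for given points and in expectation -/

theorem mainTheorem8 {d : ℕ} (Ω : Set (EuclideanSpace ℝ (Fin d)))
    (hΩb : Bornology.IsBounded Ω) (hΩc : Convex ℝ Ω) (hΩm : MeasurableSet Ω)
    (μ ν : Measure Ω) [IsFiniteMeasure μ] [IsFiniteMeasure ν] (hμ : μ ≠ 0) (hν : ν ≠ 0)
    (φ₀ ψ₀ : Ω →ᵇ ℝ) (hdual : UOT.IsOptimalDualPair μ ν φ₀ ψ₀)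
    (n m : ℕ) (hn : 0 < n) (hm : 0 < m) :
    (∀ (x : Fin n → Ω) (y : Fin m → Ω) (G : Matrix (Fin n) (Fin m) ℝ),
      UOT.IsOptimalEmpiricalPlan μ ν x y G →
        UOT.uot (UOT.oracleEmpirical μ x) (UOT.oracleEmpirical ν y)
            - (∫ z, UOT.effective φ₀ z ∂(UOT.oracleEmpirical μ x))
            - (∫ z, UOT.effective ψ₀ z ∂(UOT.oracleEmpirical ν y))
          = UOT.excessDecomposition μ ν φ₀ ψ₀ x y G
        ∧ 0 ≤ UOT.excessDecomposition μ ν φ₀ ψ₀ x y G) ∧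
    (∀ (S : Type*) [MeasurableSpace S] (P : Measure S) [IsProbabilityMeasure P]
      (X : Fin n → S → Ω) (Y : Fin m → S → Ω) (γ : S → Matrix (Fin n) (Fin m) ℝ),
      (∀ i, HasLaw (X i) (UOT.normalized μ) P) →
      (∀ j, HasLaw (Y j) (UOT.normalized ν) P) →
      iIndepFun (Sum.elim X Y) P →
      (∀ᵐ ω ∂P, UOT.IsOptimalEmpiricalPlan μ ν (fun i => X i ω) (fun j => Y j ω) (γ ω)) →
        Integrable (fun ω => UOT.excessDecomposition μ ν φ₀ ψ₀
          (fun i => X i ω) (fun j => Y j ω) (γ ω)) P ∧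
        Integrable (fun ω => UOT.uot (UOT.oracleEmpirical μ (fun i => X i ω))
          (UOT.oracleEmpirical ν (fun j => Y j ω)) - UOT.uot μ ν) P ∧
        ∫ ω, UOT.excessDecomposition μ ν φ₀ ψ₀
            (fun i => X i ω) (fun j => Y j ω) (γ ω) ∂P
          = ∫ ω, (UOT.uot (UOT.oracleEmpirical μ (fun i => X i ω))
              (UOT.oracleEmpirical ν (fun j => Y j ω)) - UOT.uot μ ν) ∂P) := by
  refine ⟨fun x y G hG => ⟨UOT.uot_oracleEmpirical_sub_eq_excessDecomposition hμ hν hn hm φ₀ ψ₀ x y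
    hG, UOT.excessDecomposition_nonneg μ ν (UOT.atomMass_pos hμ hn) (UOT.atomMass_pos hν hm)
      hdual.feasible x y hG.nonneg⟩, ?_⟩
  intro S _ P _ X Y γ hX hY _ hγ
  have hU := UOT.integrable_uot_oracleEmpirical hμ hν hn hm (fun i => (hX i).aemeasurable)
    fun j => (hY j).aemeasurable
  have hζ := UOT.integrable_integral_effective_oracleEmpirical hX φ₀
  have hξ := UOT.integrable_integral_effective_oracleEmpirical hY ψ₀
  have hae : (fun ω => UOT.uot (UOT.oracleEmpirical μ fun i => X i ω)
        (UOT.oracleEmpirical ν fun j => Y j ω)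
        - (∫ z, UOT.effective φ₀ z ∂(UOT.oracleEmpirical μ fun i => X i ω))
        - ∫ z, UOT.effective ψ₀ z ∂(UOT.oracleEmpirical ν fun j => Y j ω))
      =ᵐ[P] fun ω => UOT.excessDecomposition μ ν φ₀ ψ₀ (fun i => X i ω) (fun j => Y j ω) (γ ω) := by
    filter_upwards [hγ] with ω hω
    exact UOT.uot_oracleEmpirical_sub_eq_excessDecomposition hμ hν hn hm φ₀ ψ₀ _ _ hω
  -- No measurable selection of plans is needed: the excess inherits integrability from the left
  -- side of the identity, which does not involve `γ`.
  refine ⟨((hU.sub hζ).sub hξ).congr hae, hU.sub (integrable_const _), ?_⟩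
  rw [← integral_congr_ae hae]
  refine (integral_sub (hU.sub hζ) hξ).trans ?_
  rw [integral_sub' hU hζ, integral_sub hU (integrable_const _),
    UOT.integral_integral_effective_oracleEmpirical hμ hn hX φ₀,
    UOT.integral_integral_effective_oracleEmpirical hν hm hY ψ₀,
    hdual.uot_eq_dualObjective hΩb hΩm hμ, UOT.dualObjective, UOT.effective_eq, UOT.effective_eq]
  simp
  ring
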